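/- Let $R$ and $S$ be associative rings with unit and let $n\ge 1$ be an integer; modules are left modules unless stated otherwise, and right $R$-modules are regarded as $R^{op}$-modules. Let $C={}_SC_R$ be a semidualizing $(S,R)$-bimodule, i.e. ${}_SC$ and $C_R$ admit resolutions by finitely generated projective $S$-modules, respectively $R^{op}$-modules; the homothety maps $S\to\operatorname{Hom}_{R^{op}}(C,C)$, $s\mapsto(c\mapsto sc)$, and $R\to\operatorname{Hom}_S(C,C)$, $r\mapsto(c\mapsto cr)$, are bijective; and $\operatorname{Ext}^i_S(C,C)=0=\operatorname{Ext}^i_{R^{op}}(C,C)$ for all $i\ge 1$. A module $M$ over a ring $A$ is finitely $n$-presented if there is an exact sequence $F_n\to F_{n-1}\to\cdots\to F_0\to M\to 0$ of $A$-modules with every $F_i$ finitely generated and free. An $S$-module $X$ is $fp_n$-injective if $\operatorname{Hom}_S(L,X)\to\operatorname{Hom}_S(K,X)$ is surjective for every monomorphism $K\to L$ of finitely $n$-presented $S$-modules. An $R$-module $Y$ is $fp_n$-flat if $K\otimes_RY\to L\otimes_RY$ is injective for every monomorphism $K\to L$ of finitely $n$-presented $R^{op}$-modules. Let $Cfp_nI(R)$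 be the class of $R$-modules isomorphic to $\operatorname{Hom}_S(C,X)$ for some $fp_n$-injective $S$-module $X$, and let $Cfp_nF(S)$ be the class of $S$-modules isomorphic to $C\otimes_RY$ for some $fp_n$-flat $R$-module $Y$. For a class $\mathcal F$ of modules over a ring, an $\mathcal F$-preenvelope of a module $M$ is a homomorphism $f:M\to F$ with $F\in\mathcal F$ such that every homomorphism $M\to F'$ with $F'\in\mathcal F$ factors through $f$. An $\mathcal F$-cover of $M$ is a homomorphism $f:F\to M$ with $F\in\mathcal F$ such that every homomorphism $F'\to M$ with $F'\in\mathcal F$ factors through $f$, and every endomorphism $g$ of $F$ with $fg=f$ is an automorphism. The class $\mathcal F$ is preenveloping (respectively covering) if every module over the ring has an $\mathcal F$-preenvelope (respectively an $\mathcal F$-cover). **Theorem.** The class $Cfp_nI(R)$ of $R$-modules is preenveloping and covering, and the class $Cfp_nF(S)$ of $S$-modules is preenveloping and covering. -/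

import Mathlib

open CategoryTheory MulOpposite
open scoped TensorProduct

universe u

/-! Right `R`-modules are modules over `Rᵐᵒᵖ`; an `(S, R)`-bimodule is an abelian group `C` with
`[Module S C] [Module Rᵐᵒᵖ C] [SMulCommClass S Rᵐᵒᵖ C]`. -/

namespace CfpModules

section Presentations

variable (R : Type u) [Ring R] (M : Type u) [AddCommGroup M] [Module R M]

/-- `M` is finitely `n`-presented: there is an exact sequence `F n → ⋯ → F 1 → F 0 → M → 0` with
each `F i = R ^ k i` free of finite rank. Only `d 0, …, d (n - 1)` matter; the values `k i` for
`i > n` and `d i` for `i ≥ n` are unconstrained. -/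
def FinitelyPresented (n : ℕ) : Prop :=
  ∃ (k : ℕ → ℕ) (d : ∀ i, (Fin (k (i + 1)) → R) →ₗ[R] (Fin (k i) → R))
    (ε : (Fin (k 0) → R) →ₗ[R] M),
    Function.Surjective ε ∧ (0 < n → Function.Exact (d 0) ε) ∧
      ∀ i, i + 1 < n → Function.Exact (d (i + 1)) (d i)

/-- `M` has a resolution `⋯ → P 1 → P 0 → M → 0` by finitely generated projective modules. -/
def HasDegreewiseFiniteProjectiveResolution : Prop :=
  ∃ (P : ℕ → ModuleCat.{u} R) (d : ∀ i, P (i + 1) →ₗ[R] P i) (ε : P 0 →ₗ[R] M),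
    (∀ i, Module.Finite R (P i) ∧ Module.Projective R (P i)) ∧
      Function.Surjective ε ∧ Function.Exact (d 0) ε ∧
      ∀ i, Function.Exact (d (i + 1)) (d i)

end Presentations

section Tensor

variable (R : Type*) [Ring R] (K L : Type*) [AddCommGroup K] [Module Rᵐᵒᵖ K]
variable [AddCommGroup L] [Module Rᵐᵒᵖ L] (Y : Type*) [AddCommGroup Y] [Module R Y]

/-- The subgroup of `K ⊗[ℤ] Y` generated by all `(k r) ⊗ y - k ⊗ (r y)`. -/
def balancingSubgroup : AddSubgroup (K ⊗[ℤ] Y) :=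
  AddSubgroup.closure {t | ∃ (k : K) (r : R) (y : Y), t = (op r • k) ⊗ₜ[ℤ] y - k ⊗ₜ[ℤ] (r • y)}

/-- The tensor product `K ⊗_R Y` of a right `R`-module `K` and a left `R`-module `Y`. -/
def BalancedTensor : Type _ := (K ⊗[ℤ] Y) ⧸ balancingSubgroup R K Y

instance : AddCommGroup (BalancedTensor R K Y) :=
  inferInstanceAs (AddCommGroup ((K ⊗[ℤ] Y) ⧸ balancingSubgroup R K Y))

variable {R K L}

/-- The map `f ⊗ Y : K ⊗_R Y → L ⊗_R Y` induced by a map `f : K → L` of right `R`-modules. -/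
def balancedMap (f : K →ₗ[Rᵐᵒᵖ] L) : BalancedTensor R K Y →+ BalancedTensor R L Y :=
  QuotientAddGroup.map (balancingSubgroup R K Y) (balancingSubgroup R L Y)
    (LinearMap.rTensor Y f.toAddMonoidHom.toIntLinearMap).toAddMonoidHom <| by
      refine (AddSubgroup.closure_le _).2 ?_
      rintro _ ⟨k, r, y, rfl⟩
      refine AddSubgroup.subset_closure ⟨f k, r, y, ?_⟩
      simp

end Tensor

section Hom

variable (R S : Type*) [Ring R] [Ring S]
variable (C : Type*) [AddCommGroup C] [Module S C] [Module Rᵐᵒᵖ C] [SMulCommClass S Rᵐᵒᵖ C]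
variable (X : Type*) [AddCommGroup X] [Module S X]

/-- The map `c ↦ s c`, as an endomorphism of the right `R`-module `C`. -/
def leftHomothety (s : S) : C →ₗ[Rᵐᵒᵖ] C where
  toFun c := s • c
  map_add' := smul_add s
  map_smul' r c := smul_comm s r c

/-- The map `c ↦ c r`, as an endomorphism of the left `S`-module `C`. -/
def rightHomothety (r : R) : C →ₗ[S] C where
  toFun c := op r • c
  map_add' := smul_add (op r)
  map_smul' s c := (smul_comm s (op r) c).symm

/-- The left `R`-module structure `(r f)(c) = f (c r)` on `Hom_S(C, X)`. -/
@[reducible] def homModule : Module R (C →ₗ[S] X) where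
  smul r f := f.comp (rightHomothety R S C r)
  one_smul f := LinearMap.ext fun c => congrArg f (one_smul Rᵐᵒᵖ c)
  mul_smul r r' f := LinearMap.ext fun c => congrArg f (mul_smul (op r') (op r) c)
  smul_zero _ := rfl
  smul_add _ _ _ := rfl
  add_smul r r' f := LinearMap.ext fun c =>
    (congrArg f (add_smul (op r) (op r') c)).trans (map_add f _ _)
  zero_smul f := LinearMap.ext fun c => (congrArg f (zero_smul Rᵐᵒᵖ c)).trans (map_zero f)

end Hom

section TensorModule

variable (R : Type*) [Ring R] (S : Type*) [Ring S]
variable (C : Type*) [AddCommGroup C] [Module S C] [Module Rᵐᵒᵖ C] [SMulCommClass S Rᵐᵒᵖ C]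
variable (Y : Type*) [AddCommGroup Y] [Module R Y]

/-- Two additive maps out of `C ⊗_R Y` agree if they agree on all `c ⊗ y`. -/
theorem balancedTensor_hom_ext {A : Type*} [AddCommGroup A] {φ ψ : BalancedTensor R C Y →+ A}
    (h : ∀ (c : C) (y : Y), φ (QuotientAddGroup.mk (c ⊗ₜ[ℤ] y)) =
      ψ (QuotientAddGroup.mk (c ⊗ₜ[ℤ] y))) : φ = ψ := by
  refine AddMonoidHom.ext fun t => ?_
  obtain ⟨x, rfl⟩ := QuotientAddGroup.mk_surjective t
  induction x with
  | zero => exact (map_zero φ).trans (map_zero ψ).symm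
  | tmul c y => exact h c y
  | add x y hx hy =>
    exact (map_add φ _ _).trans ((congrArg₂ (· + ·) hx hy).trans (map_add ψ _ _).symm)

/-- The left `S`-module structure `s (c ⊗ y) = (s c) ⊗ y` on `C ⊗_R Y`. -/
instance balancedTensorModule : Module S (BalancedTensor R C Y) where
  smul s := balancedMap Y (leftHomothety R S C s)
  one_smul := DFunLike.congr_fun (F := BalancedTensor R C Y →+ BalancedTensor R C Y)
    (f := balancedMap Y (leftHomothety R S C 1)) (g := AddMonoidHom.id _)
    (balancedTensor_hom_ext R C Y fun c y =>
      congrArg (fun z => QuotientAddGroup.mk (z ⊗ₜ[ℤ] y)) (one_smul S c))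
  mul_smul s s' := DFunLike.congr_fun (F := BalancedTensor R C Y →+ BalancedTensor R C Y)
    (f := balancedMap Y (leftHomothety R S C (s * s')))
    (g := (balancedMap Y (leftHomothety R S C s)).comp (balancedMap Y (leftHomothety R S C s')))
    (balancedTensor_hom_ext R C Y fun c y =>
      congrArg (fun z => QuotientAddGroup.mk (z ⊗ₜ[ℤ] y)) (mul_smul s s' c))
  smul_zero s := map_zero (balancedMap Y (leftHomothety R S C s))
  smul_add s := map_add (balancedMap Y (leftHomothety R S C s))
  add_smul s s' := DFunLike.congr_fun (F := BalancedTensor R C Y →+ BalancedTensor R C Y)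
    (f := balancedMap Y (leftHomothety R S C (s + s')))
    (g := balancedMap Y (leftHomothety R S C s) + balancedMap Y (leftHomothety R S C s'))
    (balancedTensor_hom_ext R C Y fun c y =>
      congrArg QuotientAddGroup.mk ((congrArg (· ⊗ₜ[ℤ] y) (add_smul s s' c)).trans
        (TensorProduct.add_tmul _ _ _)))
  zero_smul := DFunLike.congr_fun (F := BalancedTensor R C Y →+ BalancedTensor R C Y)
    (f := balancedMap Y (leftHomothety R S C 0)) (g := 0)
    (balancedTensor_hom_ext R C Y fun c y =>
      congrArg QuotientAddGroup.mk ((congrArg (· ⊗ₜ[ℤ] y) (zero_smul S c)).trans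
        (TensorProduct.zero_tmul _ _)))

end TensorModule

section Semidualizing

variable (R S : Type u) [Ring R] [Ring S]
variable (C : Type u) [AddCommGroup C] [Module S C] [Module Rᵐᵒᵖ C] [SMulCommClass S Rᵐᵒᵖ C]

/-- The `(S, R)`-bimodule `C` is semidualizing. -/
structure IsSemidualizing : Prop where
  left_resolution : HasDegreewiseFiniteProjectiveResolution S C
  right_resolution : HasDegreewiseFiniteProjectiveResolution Rᵐᵒᵖ C
  left_homothety : Function.Bijective (leftHomothety R S C)
  right_homothety : Function.Bijective (rightHomothety R S C)
  left_ext : ∀ i : ℕ, 1 ≤ i →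
    Subsingleton (Abelian.Ext (ModuleCat.of S C) (ModuleCat.of S C) i)
  right_ext : ∀ i : ℕ, 1 ≤ i →
    Subsingleton (Abelian.Ext (ModuleCat.of Rᵐᵒᵖ C) (ModuleCat.of Rᵐᵒᵖ C) i)

end Semidualizing

section Classes

variable (n : ℕ)

/-- `M` is `fp_n`-injective: maps to `M` extend along every monomorphism between finitely
`n`-presented modules. -/
def IsFpInjective (R : Type u) [Ring R] (M : Type u) [AddCommGroup M] [Module R M] : Prop :=
  ∀ (K L : ModuleCat.{u} R) (f : K →ₗ[R] L), FinitelyPresented R K n → FinitelyPresented R L n →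
    Function.Injective f → Function.Surjective fun g : L →ₗ[R] M => g.comp f

/-- `M` is `fp_n`-flat: `- ⊗_R M` preserves monomorphisms between finitely `n`-presented right
modules. -/
def IsFpFlat (R : Type u) [Ring R] (M : Type u) [AddCommGroup M] [Module R M] : Prop :=
  ∀ (K L : ModuleCat.{u} Rᵐᵒᵖ) (f : K →ₗ[Rᵐᵒᵖ] L),
    FinitelyPresented Rᵐᵒᵖ K n → FinitelyPresented Rᵐᵒᵖ L n →
      Function.Injective f → Function.Injective (balancedMap M f)

variable (R S : Type u) [Ring R] [Ring S]
variable (C : Type u) [AddCommGroup C] [Module S C] [Module Rᵐᵒᵖ C] [SMulCommClass S Rᵐᵒᵖ C]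

/-- The class of `C`-`fp_n`-injective left `R`-modules: those isomorphic to `Hom_S(C, X)` for
some `fp_n`-injective left `S`-module `X`. -/
def CfpInjective : ObjectProperty (ModuleCat.{u} R) := fun M =>
  ∃ X : ModuleCat.{u} S, IsFpInjective n S X ∧
    letI := homModule R S C X
    Nonempty (M ≃ₗ[R] (C →ₗ[S] X))

/-- The class of `C`-`fp_n`-flat left `S`-modules: those isomorphic to `C ⊗_R Y` for some
`fp_n`-flat left `R`-module `Y`. -/
def CfpFlat : ObjectProperty (ModuleCat.{u} S) := fun N =>
  ∃ Y : ModuleCat.{u} R, IsFpFlat n R Y ∧ Nonempty (N ≃ₗ[S] BalancedTensor R C Y)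

end Classes

section Approximations

variable {R : Type u} [Ring R] (𝓕 : ObjectProperty (ModuleCat.{u} R))

/-- `f : M → F` is an `𝓕`-preenvelope of `M`. -/
def IsPreenvelope {M F : ModuleCat.{u} R} (f : M ⟶ F) : Prop :=
  𝓕 F ∧ ∀ F' : ModuleCat.{u} R, 𝓕 F' → ∀ g : M ⟶ F', ∃ h : F ⟶ F', f ≫ h = g

/-- `f : F → M` is an `𝓕`-precover of `M`. -/
def IsPrecover {M F : ModuleCat.{u} R} (f : F ⟶ M) : Prop :=
  𝓕 F ∧ ∀ F' : ModuleCat.{u} R, 𝓕 F' → ∀ g : F' ⟶ M, ∃ h : F' ⟶ F, h ≫ f = g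

/-- `f : F → M` is an `𝓕`-cover of `M`. -/
def IsCover {M F : ModuleCat.{u} R} (f : F ⟶ M) : Prop :=
  IsPrecover 𝓕 f ∧ ∀ g : F ⟶ F, g ≫ f = f → IsIso g

/-- Every module has an `𝓕`-preenvelope. -/
def IsPreenveloping : Prop :=
  ∀ M : ModuleCat.{u} R, ∃ (F : ModuleCat.{u} R) (f : M ⟶ F), IsPreenvelope 𝓕 f

/-- Every module has an `𝓕`-cover. -/
def IsCovering : Prop :=
  ∀ M : ModuleCat.{u} R, ∃ (F : ModuleCat.{u} R) (f : F ⟶ M), IsCover 𝓕 f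

end Approximations

end CfpModules

/-! Both classes are closed under isomorphisms, products, pure submodules and pure quotients
(`IsPurityClosed`), and every class with these closure properties is preenveloping and covering.

Preenvelopes: a map from `M` into a member of the class lands in a pure submodule of size bounded in
terms of `M`, so the product over a set of representatives is a preenvelope. Precovers: dividing the
source of a map to `M` by a maximal pure submodule of the kernel leaves a module of bounded size
(`exists_bound_of_no_pure_in_ker`), so a direct sum over representatives is a precover. Covers:
transfinite gluing of copies of a precover `T → M` first produces a precover all of whose
endomorphisms over `M` are injective, and a second gluing shows that these endomorphisms are then
bijective. The colimits that occur are realized inside one direct sum of copies of `T`, as quotients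
by pure submodules, and therefore stay in the class.

For the closure properties, a finite presentation of `C` over one ring dualizes, by the homothety
isomorphisms, to an exact sequence `0 → B → C ^ k → C ^ m` over the other ring `B`, whose maps come
from monomorphisms of finitely `n`-presented modules (`exists_copresentation`). Hence `C ⊗ Hom(C, X)
→ X` is bijective for `fp_n`-injective `X`, and `Y → Hom(C, C ⊗ Y)` is bijective for `fp_n`-flat
`Y`. As `C` is finitely presented on both sides, `C ⊗ -` commutes with products and preserves
purity, and pure submodules of `C ⊗ Y` come from pure submodules of `Y`. This carries over the
closure properties of `fp_n`-injective and `fp_n`-flat modules; for pure submodules and quotients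
these rest on finite presentation of the test modules, which is where `n ≥ 1` enters. -/

namespace CfpModules

/-! ### Pure submodules and bounds on their size -/

section Purity

variable {R : Type u} [Ring R] {B : Type u} [AddCommGroup B] [Module R B]

/-- `P` is pure relative to `Q`: every finite system of linear equations with constants in `P`
which has a solution in `Q` has a solution in `P`. -/
def IsPureIn (P Q : Submodule R B) : Prop :=
  ∀ (m n : ℕ) (A : Matrix (Fin m) (Fin n) R) (x : Fin n → B), (∀ j, x j ∈ Q) →
    (∀ i, ∑ j, A i j • x j ∈ P) →
      ∃ y : Fin n → B, (∀ j, y j ∈ P) ∧ ∀ i, ∑ j, A i j • y j = ∑ j, A i j • x j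

/-- `P` is a pure submodule. -/
abbrev IsPure (P : Submodule R B) : Prop := IsPureIn P ⊤

theorem IsPureIn.isPure_submoduleOf {P Q : Submodule R B} (h : IsPureIn P Q) (hPQ : P ≤ Q) :
    IsPure (P.submoduleOf Q) := by
  intro m n A x _ hx
  obtain ⟨y, hy, hxy⟩ := h m n A (fun j => (x j : B)) (fun j => (x j).2) fun i => by
    simpa [Submodule.submoduleOf] using hx i
  refine ⟨fun j => ⟨y j, hPQ (hy j)⟩, fun j => hy j, fun i => Subtype.ext ?_⟩
  simpa using hxy i

theorem isPure_map_equiv {B' : Type u} [AddCommGroup B'] [Module R B'] (e : B ≃ₗ[R] B')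
    {P : Submodule R B} (hP : IsPure P) : IsPure (P.map (e : B →ₗ[R] B')) := by
  intro m n A x _ hx
  obtain ⟨y, hy, hxy⟩ := hP m n A (fun j => e.symm (x j)) (fun _ => trivial) fun i => by
    obtain ⟨p, hp, h⟩ := hx i
    have : ∑ j, A i j • e.symm (x j) = p := e.injective (by simpa using h.symm)
    rwa [this]
  refine ⟨fun j => e (y j), fun j => ⟨_, hy j, rfl⟩, fun i => e.symm.injective ?_⟩
  simpa using hxy i

/-- Only finitely many right-hand sides occur, each of finite support; truncating a solution in the
product to the union of these supports gives a solution in the direct sum. -/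
theorem isPure_finiteSupport {ι : Type u} (F : ι → Type u) [∀ i, AddCommGroup (F i)]
    [∀ i, Module R (F i)] [DecidableEq ι] :
    IsPure (LinearMap.range (DFinsupp.coeFnLinearMap R : (Π₀ i, F i) →ₗ[R] ∀ i, F i)) := by
  classical
  intro m n A x _ hx
  choose z hz using hx
  let s : Finset ι := Finset.univ.biUnion fun i => (z i).support
  refine ⟨fun j => DFinsupp.mk s fun i => x j i, fun j => ⟨DFinsupp.mk s fun i => x j i, rfl⟩,
    fun i => ?_⟩
  funext k
  have hk := congrFun (hz i) k
  by_cases hks : k ∈ s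
  · simp [hks]
  · have : z i k = 0 := by
      by_contra h
      exact hks (Finset.mem_biUnion.2 ⟨i, Finset.mem_univ _, DFinsupp.mem_support_iff.2 h⟩)
    simp only [DFinsupp.coeFnLinearMap_apply, this] at hk
    rw [← hk]
    simp [hks]

/-- A set closed under a family of operations which is the range of a map from a type that only
depends on the signature. -/
theorem exists_range_closed {α : Type u} {β : α → Type u} {F : Type u}
    (op : ∀ a, (β a → F) → F) :
    ∃ w : WType β → F, ∀ a (t : β a → F), (∀ b, t b ∈ Set.range w) → op a t ∈ Set.range w := by
  refine ⟨WType.elim F fun x => op x.1 x.2, fun a t ht => ?_⟩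
  choose s hs using ht
  exact ⟨⟨a, s⟩, by simp only [WType.elim, hs]⟩

theorem exists_submodule_range_eq {W F : Type u} [AddCommGroup F] [Module R F] (w : W → F)
    (x₀ : W) (h : ∀ (r : R) a b, a ∈ Set.range w → b ∈ Set.range w → r • a + b ∈ Set.range w) :
    ∃ P : Submodule R F, Set.range w = P := by
  have h0 : (0 : F) ∈ Set.range w := by
    have := h (-1) _ _ ⟨x₀, rfl⟩ ⟨x₀, rfl⟩
    simpa using this
  exact ⟨{ carrier := Set.range w
           add_mem' := fun {a b} ha hb => by simpa using h 1 a b ha hb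
           zero_mem' := h0
           smul_mem' := fun r a ha => by simpa using h r a 0 ha h0 }, rfl⟩

variable (R) in
/-- Every family of elements is contained in a pure submodule of bounded size. -/
theorem exists_small_pure (X : Type u) : ∃ W : Type u, ∀ (F : Type u) [AddCommGroup F]
    [Module R F] (a : X → F), ∃ P : Submodule R F, IsPure P ∧ (∀ x, a x ∈ P) ∧
      ∃ w : W → F, Set.range w = P := by
  classical
  -- The operations are the constants `0` and `a x`, the combinations `r • s + t`, and each
  -- coordinate of a chosen solution of each finite system, as a function of its right-hand sides.
  -- The signature does not involve `F`, so neither does the bound.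
  let α : Type u := Option X ⊕ R ⊕ Σ m n : ℕ, Matrix (Fin m) (Fin n) R × Fin n
  let β : α → Type u := Sum.elim (fun _ => PEmpty)
    (Sum.elim (fun _ => ULift Bool) fun s => ULift (Fin s.1))
  refine ⟨WType β, fun F _ _ a => ?_⟩
  let sol : ∀ m n : ℕ, Matrix (Fin m) (Fin n) R → (Fin m → F) → Fin n → F := fun m n A c =>
    if h : ∃ x : Fin n → F, ∀ i, ∑ j, A i j • x j = c i then h.choose else 0
  have hsol : ∀ m n (A : Matrix (Fin m) (Fin n) R) (x : Fin n → F) i,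
      ∑ j, A i j • sol m n A (fun i => ∑ j, A i j • x j) j = ∑ j, A i j • x j := by
    intro m n A x i
    have h : ∃ y : Fin n → F, ∀ i, ∑ j, A i j • y j = ∑ j, A i j • x j := ⟨x, fun _ => rfl⟩
    simp only [sol, dif_pos h]
    exact h.choose_spec i
  let op : ∀ s : α, (β s → F) → F := fun s => match s with
    | .inl x => fun _ => x.elim 0 a
    | .inr (.inl r) => fun t => r • t ⟨false⟩ + t ⟨true⟩
    | .inr (.inr s) => fun t => sol s.1 s.2.1 s.2.2.1 (fun i => t ⟨i⟩) s.2.2.2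
  obtain ⟨w, hw⟩ := exists_range_closed op
  obtain ⟨P, hP⟩ := exists_submodule_range_eq (R := R) w ⟨.inl none, PEmpty.elim⟩
    fun r x y hx hy => hw (.inr (.inl r)) (fun b => if b.down then y else x) (by
      rintro ⟨_ | _⟩
      · simpa using hx
      · simpa using hy)
  refine ⟨P, fun m n A x _ hx => ?_, fun x => ?_, w, hP⟩
  · refine ⟨sol m n A fun i => ∑ j, A i j • x j, fun j => ?_, hsol m n A x⟩
    have := hw (.inr (.inr ⟨m, n, A, j⟩)) (fun i => ∑ j, A i.down j • x j) fun i => by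
      rw [hP]; exact hx _
    rw [hP] at this
    exact this
  · have := hw (.inl (some x)) PEmpty.elim (fun b => b.elim)
    rw [hP] at this
    exact this

/-- A submodule of bounded size which realizes all linear maps from `N`, relative to a map `f`
and to their partial values in the submodule. -/
theorem exists_small_reflecting (N M : Type u) [AddCommGroup N] [Module R N] [AddCommGroup M]
    [Module R M] : ∃ W : Type u, ∀ (F : Type u) [AddCommGroup F] [Module R F] (f : F →ₗ[R] M),
      ∃ P : Submodule R F, (∃ w : W → F, Set.range w = P) ∧
        ∀ g : N →ₗ[R] F, ∃ h : N →ₗ[R] F, (∀ x, h x ∈ P) ∧ (∀ x, g x ∈ P → h x = g x) ∧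
          ∀ x, f (h x) = f (g x) := by
  classical
  -- To keep the signature independent of `F`, a map `g` is recorded by the set where its values lie
  -- in the submodule and by `f ∘ g`, both labels of the operation, and by those values in the
  -- submodule, the `N`-indexed argument. The last factor `N` is the point at which the chosen map
  -- is evaluated.
  let α : Type u := Unit ⊕ R ⊕ (Set N × (N → M)) × N
  let β : α → Type u := Sum.elim (fun _ => PEmpty) (Sum.elim (fun _ => ULift Bool) fun _ => N)
  refine ⟨WType β, fun F _ _ f => ?_⟩
  let sol : Set N × (N → M) → (N → F) → N → F := fun s t =>
    if h : ∃ h : N →ₗ[R] F, (∀ x ∈ s.1, h x = t x) ∧ ∀ x, f (h x) = s.2 x then h.choose else 0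
  let op : ∀ s : α, (β s → F) → F := fun s => match s with
    | .inl _ => fun _ => 0
    | .inr (.inl r) => fun t => r • t ⟨false⟩ + t ⟨true⟩
    | .inr (.inr s) => fun t => sol s.1 t s.2
  obtain ⟨w, hw⟩ := exists_range_closed op
  obtain ⟨P, hP⟩ := exists_submodule_range_eq (R := R) w ⟨.inl (), PEmpty.elim⟩
    fun r x y hx hy => hw (.inr (.inl r)) (fun b => if b.down then y else x) (by
      rintro ⟨_ | _⟩
      · simpa using hx
      · simpa using hy)
  refine ⟨P, ⟨w, hP⟩, fun g => ?_⟩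
  let s : Set N × (N → M) := ({x | g x ∈ P}, fun x => f (g x))
  let t : N → F := fun x => if g x ∈ P then g x else 0
  have hex : ∃ h : N →ₗ[R] F, (∀ x ∈ s.1, h x = t x) ∧ ∀ x, f (h x) = s.2 x :=
    ⟨g, fun x (hx : g x ∈ P) => by simp [t, hx], fun _ => rfl⟩
  have hs : sol s t = hex.choose := dif_pos hex
  refine ⟨hex.choose, fun x => ?_, fun x hx => ?_, hex.choose_spec.2⟩
  · have := hw (.inr (.inr (s, x))) t fun b => by
      rw [hP]
      by_cases hb : g b ∈ P <;> simp [t, hb]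
    rw [hP] at this
    rw [← hs]
    exact this
  · exact (hex.choose_spec.1 x hx).trans (by simp [t, hx])

variable (R) in
/-- If no nonzero pure submodule of `F` is contained in the kernel of a map `F → M`, then the size
of `F` is bounded in terms of `M`. -/
theorem exists_bound_of_no_pure_in_ker (M : Type u) [AddCommGroup M] [Module R M] :
    ∃ W : Type u, ∀ (F : Type u) [AddCommGroup F] [Module R F] (f : F →ₗ[R] M),
      (∀ P : Submodule R F, IsPure P → P ≤ LinearMap.ker f → P = ⊥) →
        ∃ w : W → F, Function.Surjective w := by
  obtain ⟨I, hI⟩ := exists_small_pure R PUnit.{u + 1}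
  obtain ⟨W, hW⟩ := exists_small_reflecting (R := R) (I →₀ R) M
  refine ⟨W, fun F _ _ f hf => ?_⟩
  obtain ⟨F₀, ⟨w, hw⟩, href⟩ := hW F f
  suffices h : ∀ y, y ∈ F₀ from ⟨w, fun y => by
    have := h y
    rwa [← SetLike.mem_coe, ← hw] at this⟩
  intro y
  by_contra hy
  obtain ⟨Q, hQ, hyQ, v, hv⟩ := hI (F ⧸ F₀) fun _ => F₀.mkQ y
  choose γ hγ using fun i => F₀.mkQ_surjective (v i)
  let g : (I →₀ R) →ₗ[R] F := Finsupp.linearCombination R γ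
  obtain ⟨h, hh, hgh, hfh⟩ := href g
  -- The map `g - h` kills whatever `g` sends into `F₀`, so it factors through `Q`; as `h` has
  -- values in `F₀`, it is a section over `Q` of `F → F ⧸ F₀`. Its range is a copy of `Q` inside the
  -- kernel of `f`, and it inherits purity from `Q`. If it vanishes, then `y ∈ F₀`.
  have hδ : ∀ c, g c ∈ F₀ → (g - h) c = 0 := fun c hc => by simp [hgh c hc]
  have hgQ : ∀ c, F₀.mkQ (g c) ∈ Q := by
    intro c
    induction c using Finsupp.induction_linear with
    | zero => simp
    | add a b ha hb => simpa using Q.add_mem ha hb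
    | single i r =>
      have : v i ∈ (Q : Set (F ⧸ F₀)) := hv ▸ ⟨i, rfl⟩
      have h2 : F₀.mkQ (g (Finsupp.single i r)) = r • v i := by
        rw [← hγ, ← map_smul]; simp [g]
      rw [h2]
      exact Q.smul_mem _ this
  have hQg : ∀ q ∈ Q, ∃ c, F₀.mkQ (g c) = q := by
    intro q hq
    rw [← SetLike.mem_coe, ← hv] at hq
    obtain ⟨i, rfl⟩ := hq
    exact ⟨Finsupp.single i 1, by simp only [g, Finsupp.linearCombination_single, one_smul, hγ]⟩
  have hmk : ∀ a b, F₀.mkQ a = F₀.mkQ b ↔ a - b ∈ F₀ := fun a b => Submodule.Quotient.eq F₀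
  have hbot := hf (LinearMap.range (g - h)) ?_ ?_
  · obtain ⟨c, hc⟩ := hQg _ (hyQ ⟨⟩)
    have h0 : (g - h) c = 0 := by
      have : (g - h) c ∈ LinearMap.range (g - h) := ⟨c, rfl⟩
      rwa [hbot] at this
    rw [hmk] at hc
    have h1 : g c ∈ F₀ := by
      rw [LinearMap.sub_apply, sub_eq_zero] at h0
      exact h0 ▸ hh c
    exact hy (by simpa using F₀.sub_mem h1 hc)
  · intro m n A x _ hx
    choose c hc using hx
    have hsub : ∀ i, F₀.mkQ (∑ j, A i j • x j) = F₀.mkQ (g (c i)) := fun i => by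
      rw [hmk, ← hc]
      simpa using F₀.neg_mem (hh (c i))
    obtain ⟨z, hz, hzx⟩ := hQ m n A (fun j => F₀.mkQ (x j)) (fun _ => trivial) fun i => by
      have := hgQ (c i)
      rw [← hsub] at this
      simpa using this
    choose e he using fun j => hQg (z j) (hz j)
    refine ⟨fun j => (g - h) (e j), fun j => ⟨_, rfl⟩, fun i => ?_⟩
    have key : g (∑ j, A i j • e j - c i) ∈ F₀ := by
      rw [map_sub, ← hmk, ← hsub, map_sum, map_sum, map_sum]
      simpa [he] using hzx i
    have := hδ _ key
    rw [map_sub, sub_eq_zero, hc] at this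
    rw [← this, map_sum]
    simp
  · rintro _ ⟨c, rfl⟩
    simp [hfh]

end Purity

/-! ### Preenvelopes and precovers from closure under purity -/

section Approximation

variable {R : Type u} [Ring R]

/-- A class of modules closed under isomorphisms, products, pure submodules and pure quotients. -/
structure IsPurityClosed (𝓕 : ObjectProperty (ModuleCat.{u} R)) : Prop where
  of_equiv : ∀ {M N : Type u} [AddCommGroup M] [Module R M] [AddCommGroup N] [Module R N],
    (M ≃ₗ[R] N) → 𝓕 (.of R M) → 𝓕 (.of R N)
  pi : ∀ {ι : Type u} (F : ι → Type u) [∀ i, AddCommGroup (F i)] [∀ i, Module R (F i)],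
    (∀ i, 𝓕 (.of R (F i))) → 𝓕 (.of R (∀ i, F i))
  pure_sub : ∀ {M : Type u} [AddCommGroup M] [Module R M] (P : Submodule R M),
    𝓕 (.of R M) → IsPure P → 𝓕 (.of R P)
  pure_quotient : ∀ {M : Type u} [AddCommGroup M] [Module R M] (P : Submodule R M),
    𝓕 (.of R M) → IsPure P → 𝓕 (.of R (M ⧸ P))

variable {𝓕 : ObjectProperty (ModuleCat.{u} R)}

theorem IsPurityClosed.dfinsupp (h : IsPurityClosed 𝓕) {ι : Type u} [DecidableEq ι]
    (F : ι → Type u) [∀ i, AddCommGroup (F i)] [∀ i, Module R (F i)]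
    (hF : ∀ i, 𝓕 (.of R (F i))) : 𝓕 (.of R (Π₀ i, F i)) :=
  h.of_equiv (LinearEquiv.ofInjective (DFinsupp.coeFnLinearMap R : (Π₀ i, F i) →ₗ[R] ∀ i, F i)
    DFunLike.coe_injective).symm (h.pure_sub _ (h.pi F hF) (isPure_finiteSupport F))

theorem IsPurityClosed.supported (h : IsPurityClosed 𝓕) {ι T : Type u} [AddCommGroup T]
    [Module R T] (hT : 𝓕 (.of R T)) (D : Set ι) : 𝓕 (.of R (Finsupp.supported T R D)) := by
  classical
  exact h.of_equiv ((finsuppLequivDFinsupp R).symm.trans (Finsupp.supportedEquivFinsupp D).symm)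
    (h.dfinsupp (fun _ : D => T) fun _ => hT)

variable (R) in
/-- The modules of size at most that of `W` are quotients of a single module. -/
theorem exists_quotient_equiv (W : Type u) :
    ∃ (N : Type u) (_ : AddCommGroup N) (_ : Module R N), ∀ (F : Type u) [AddCommGroup F]
      [Module R F] (w : W → F), Function.Surjective w →
        ∃ K : Submodule R N, Nonempty ((N ⧸ K) ≃ₗ[R] F) :=
  ⟨W →₀ R, inferInstance, inferInstance, fun F _ _ w hw =>
    ⟨LinearMap.ker (Finsupp.linearCombination R w),
      ⟨LinearMap.quotKerEquivOfSurjective _ fun y => by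
        obtain ⟨x, rfl⟩ := hw y
        exact ⟨Finsupp.single x 1, by simp⟩⟩⟩⟩

/-- Every map from `M` to a member of the class factors through a pure submodule of bounded size,
which is again a member and is isomorphic to a quotient of one fixed `N`. The preenvelope is the
product over all maps from `M` to quotients of `N` in the class. -/
theorem IsPurityClosed.isPreenveloping (h : IsPurityClosed 𝓕) : IsPreenveloping 𝓕 := by
  intro M
  obtain ⟨W, hW⟩ := exists_small_pure R M
  obtain ⟨N, _, _, hN⟩ := exists_quotient_equiv R W
  let ι : Type u := {p : Σ K : Submodule R N, M →ₗ[R] (N ⧸ K) //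
    𝓕 (.of R (N ⧸ p.1))}
  let K : ι → Submodule R N := fun i => i.1.1
  let φ : ∀ i, M →ₗ[R] (N ⧸ K i) := fun i => i.1.2
  refine ⟨.of R (∀ i : ι, N ⧸ K i), ModuleCat.ofHom (LinearMap.pi φ),
    h.pi _ fun i => i.2, fun F' hF' g => ?_⟩
  obtain ⟨P, hP, hgP, w, hw⟩ := hW F' g.hom
  have hwP : ∀ x, w x ∈ P := fun x => by
    rw [← SetLike.mem_coe, ← hw]; exact ⟨x, rfl⟩
  obtain ⟨K', ⟨e⟩⟩ := hN _ (fun x => (⟨w x, hwP x⟩ : P)) fun p => by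
    have := p.2
    rw [← SetLike.mem_coe, ← hw] at this
    exact this.imp fun x hx => Subtype.ext hx
  let i : ι := ⟨⟨K', (e.symm : P →ₗ[R] _) ∘ₗ g.hom.codRestrict P hgP⟩,
    h.of_equiv e.symm (h.pure_sub P hF' hP)⟩
  refine ⟨ModuleCat.ofHom (P.subtype ∘ₗ (e : _ →ₗ[R] P) ∘ₗ LinearMap.proj i), ?_⟩
  ext x
  simp [φ, K, i]

/-- Zorn's lemma applies because the finitely many right-hand sides of a system lie in a single
member of the chain. -/
theorem exists_maximal_pure_le {F : Type u} [AddCommGroup F] [Module R F] (K : Submodule R F) :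
    ∃ P : Submodule R F, IsPure P ∧ P ≤ K ∧ ∀ Q, IsPure Q → Q ≤ K → P ≤ Q → Q = P := by
  obtain ⟨P, -, hP⟩ := zorn_le_nonempty₀ {P : Submodule R F | IsPure P ∧ P ≤ K} (by
    intro c hc hchain P₀ hP₀
    have hdir := hchain.directedOn
    have hmem : ∀ {z : F}, z ∈ sSup c ↔ ∃ y ∈ c, z ∈ y :=
      Submodule.mem_sSup_of_directed ⟨P₀, hP₀⟩ hdir
    refine ⟨sSup c, ⟨fun m n A x _ hx => ?_, sSup_le fun P hP => (hc hP).2⟩,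
      fun P hP => le_sSup hP⟩
    choose Q hQ hxQ using fun i => hmem.1 (hx i)
    have : Nonempty c := ⟨⟨P₀, hP₀⟩⟩
    obtain ⟨P, hP⟩ := hdir.directed_val.finset_le (Finset.univ.image fun i => (⟨Q i, hQ i⟩ : c))
    obtain ⟨y, hy, hyx⟩ := (hc P.2).1 m n A x (fun _ => trivial) fun i =>
      hP ⟨Q i, hQ i⟩ (Finset.mem_image_of_mem _ (Finset.mem_univ i)) (hxQ i)
    exact ⟨y, fun j => hmem.2 ⟨P, P.2, hy j⟩, hyx⟩) ⊥
    ⟨fun m n A x _ hx => ⟨0, fun _ => rfl, fun i => by simpa using ((hx i : _ = _)).symm⟩, bot_le⟩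
  exact ⟨P, hP.prop.1, hP.prop.2, fun Q hQ hQK hPQ => (hP.eq_of_le ⟨hQ, hQK⟩ hPQ).symm⟩

/-- Solve modulo `P` inside `Q`, lift to `z`, and use purity of `P` to correct the error of `z`.
Consequently, after division by a maximal pure submodule of a kernel, the induced map has no nonzero
pure submodule in its kernel. -/
theorem IsPure.comap_mkQ {F : Type u} [AddCommGroup F] [Module R F] {P : Submodule R F}
    (hP : IsPure P) {Q : Submodule R (F ⧸ P)} (hQ : IsPure Q) : IsPure (Q.comap P.mkQ) := by
  intro m n A x _ hx
  obtain ⟨y, hy, hyx⟩ := hQ m n A (fun j => P.mkQ (x j)) (fun _ => trivial) fun i => by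
    simpa using hx i
  choose z hz using fun j => P.mkQ_surjective (y j)
  obtain ⟨p, hp, hpx⟩ := hP m n A (x - z) (fun _ => trivial) fun i => by
    rw [← Submodule.ker_mkQ P, LinearMap.mem_ker]
    have := hyx i
    simp only [← hz] at this
    simp only [map_sum, map_smul, Pi.sub_apply, map_sub, smul_sub, Finset.sum_sub_distrib]
    rw [this, sub_self]
  refine ⟨z + p, fun j => ?_, fun i => ?_⟩
  · have h1 : P.mkQ (p j) = 0 := by
      rw [← LinearMap.mem_ker, Submodule.ker_mkQ]; exact hp j
    rw [Submodule.mem_comap, Pi.add_apply, map_add, h1, add_zero, hz]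
    exact hy j
  · have := hpx i
    simp only [Pi.sub_apply, smul_sub, Finset.sum_sub_distrib] at this
    simp only [Pi.add_apply, smul_add, Finset.sum_add_distrib]
    rw [this]
    abel

/-- A map `g : F → M` factors through `F ⧸ P` with `P` maximal among the pure submodules of its
kernel. This quotient is in the class and of bounded size, so the direct sum over maps to `M` from
quotients of one fixed `N` in the class suffices. -/
theorem IsPurityClosed.exists_precover (h : IsPurityClosed 𝓕) (M : Type u) [AddCommGroup M]
    [Module R M] : ∃ (T : Type u) (_ : AddCommGroup T) (_ : Module R T) (f : T →ₗ[R] M),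
      𝓕 (.of R T) ∧ ∀ (F : Type u) [AddCommGroup F] [Module R F] (g : F →ₗ[R] M),
        𝓕 (.of R F) → ∃ k : F →ₗ[R] T, f ∘ₗ k = g := by
  classical
  obtain ⟨W, hW⟩ := exists_bound_of_no_pure_in_ker R M
  obtain ⟨N, _, _, hN⟩ := exists_quotient_equiv R W
  let ι : Type u := {p : Σ K : Submodule R N, (N ⧸ K) →ₗ[R] M //
    𝓕 (.of R (N ⧸ p.1))}
  let K : ι → Submodule R N := fun i => i.1.1
  let φ : ∀ i, (N ⧸ K i) →ₗ[R] M := fun i => i.1.2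
  refine ⟨Π₀ i : ι, N ⧸ K i, inferInstance, inferInstance,
    DFinsupp.lsum ℕ φ, h.dfinsupp _ fun i => i.2, fun F _ _ g hF => ?_⟩
  obtain ⟨P, hP, hPK, hmax⟩ := exists_maximal_pure_le (LinearMap.ker g)
  have hle : ∀ Q : Submodule R (F ⧸ P), Q ≤ LinearMap.ker (P.liftQ g hPK) →
      Q.comap P.mkQ ≤ LinearMap.ker g := fun Q hQ x hx => by
    simpa using hQ hx
  obtain ⟨w, hw⟩ := hW (F ⧸ P) (P.liftQ g hPK) fun Q hQ hQK => by
    have := hmax _ (hP.comap_mkQ hQ) (hle Q hQK) (P.le_comap_mkQ Q)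
    rw [← Submodule.map_comap_eq_of_surjective P.mkQ_surjective Q, this, Submodule.mkQ_map_self]
  obtain ⟨K', ⟨e⟩⟩ := hN _ w hw
  let i : ι := ⟨⟨K', P.liftQ g hPK ∘ₗ (e : _ →ₗ[R] F ⧸ P)⟩,
    h.of_equiv e.symm (h.pure_quotient P hF hP)⟩
  refine ⟨DFinsupp.lsingle i ∘ₗ (e.symm : (F ⧸ P) →ₗ[R] _) ∘ₗ P.mkQ, ?_⟩
  ext x
  simp [φ, K, i]

end Approximation

/-! ### From precovers to covers by gluing copies of a precover -/

section Cover

variable {R : Type u} [Ring R] {T M : Type u} [AddCommGroup T] [Module R T] [AddCommGroup M]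
  [Module R M] {ι : Type u}

/-- The map out of a direct sum of copies of `T` given by a family of endomorphisms. -/
noncomputable abbrev sumMap (v : ι → T →ₗ[R] T) : (ι →₀ T) →ₗ[R] T := Finsupp.lsum ℕ v

/-- The map `⊕ T → M` which is `f` on each summand. -/
noncomputable abbrev foldMap (ι : Type u) (f : T →ₗ[R] M) : (ι →₀ T) →ₗ[R] M :=
  Finsupp.lsum ℕ fun _ => f

theorem lsum_congr_of_mem_supported {N : Type u} [AddCommGroup N] [Module R N] {D : Set ι}
    {b : ι →₀ T} (hb : b ∈ Finsupp.supported T R D) {v w : ι → T →ₗ[R] N}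
    (h : ∀ j ∈ D, v j = w j) : Finsupp.lsum ℕ v b = Finsupp.lsum ℕ w b := by
  simp only [Finsupp.lsum_apply, Finsupp.sum]
  exact Finset.sum_congr rfl fun j hj => by rw [h j (((Finsupp.mem_supported R b).1 hb) hj)]

theorem foldMap_eq_of_mem_supported {f : T →ₗ[R] M} {D : Set ι} {b : ι →₀ T}
    (hb : b ∈ Finsupp.supported T R D) {v : ι → T →ₗ[R] T} (h : ∀ j ∈ D, f ∘ₗ v j = f) :
    foldMap ι f b = f (sumMap v b) := by
  rw [foldMap, lsum_congr_of_mem_supported hb fun j hj => (h j hj).symm]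
  simp [Finsupp.lsum_apply, Finsupp.sum]

/-- The relations identifying the submodule of the summands in `D`, via `v`, with the summand of
index `i`. -/
noncomputable def gluing [DecidableEq ι] (D : Set ι) (v : ι → T →ₗ[R] T) (i : ι) :
    Submodule R (ι →₀ T) :=
  Finsupp.supported T R (insert i D) ⊓
    LinearMap.ker (sumMap (Function.update v i LinearMap.id))

theorem single_mem_supported_insert (D : Set ι) (i : ι) (t : T) :
    Finsupp.single i t ∈ Finsupp.supported T R (insert i D) :=
  Finsupp.single_mem_supported R t (Set.mem_insert i D)

section Gluing

variable [DecidableEq ι] {D : Set ι} {v : ι → T →ₗ[R] T} {i : ι}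

theorem sumMap_update_of_mem_supported (hi : i ∉ D) {b : ι →₀ T}
    (hb : b ∈ Finsupp.supported T R D) :
    sumMap (Function.update v i LinearMap.id) b = sumMap v b :=
  lsum_congr_of_mem_supported hb fun j hj =>
    Function.update_of_ne (by rintro rfl; exact hi hj) _ _

theorem sumMap_update_single (t : T) :
    sumMap (Function.update v i LinearMap.id) (Finsupp.single i t) = t := by
  simp

theorem mem_gluing {b : ι →₀ T} : b ∈ gluing D v i ↔ b ∈ Finsupp.supported T R (insert i D) ∧
    sumMap (Function.update v i LinearMap.id) b = 0 := Iff.rfl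

theorem sub_single_mem_gluing {b : ι →₀ T} (hb : b ∈ Finsupp.supported T R (insert i D)) :
    b - Finsupp.single i (sumMap (Function.update v i LinearMap.id) b) ∈ gluing D v i := by
  refine mem_gluing.2 ⟨Submodule.sub_mem _ hb (single_mem_supported_insert D i _), ?_⟩
  rw [map_sub, sumMap_update_single, sub_self]

/-- The summand `i` is mapped identically to `T`, so `b ↦ b - single i (sumMap b)`, with the updated
family, retracts the sum linearly onto the gluing; applied to a solution, it gives one in the
gluing. The quotient is a copy of `T`. -/
theorem isPureIn_gluing : IsPureIn (gluing D v i) (Finsupp.supported T R (insert i D)) := by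
  intro m n A x hxD hx
  refine ⟨_, fun j => sub_single_mem_gluing (hxD j), fun k => ?_⟩
  have h : sumMap (Function.update v i LinearMap.id) (∑ j, A k j • x j) = 0 := (hx k).2
  simp only [smul_sub, Finset.sum_sub_distrib, sub_eq_self]
  rw [map_sum] at h
  simp only [map_smul] at h
  have h' := congrArg (Finsupp.lsingle i : T →ₗ[R] ι →₀ T) h
  rw [map_sum, map_zero] at h'
  simpa using h'

theorem gluing_le_ker {f : T →ₗ[R] M} (h : ∀ j ∈ D, f ∘ₗ v j = f) :
    gluing D v i ≤ LinearMap.ker (foldMap ι f) := by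
  rintro b ⟨hb, hb0⟩
  rw [LinearMap.mem_ker, foldMap_eq_of_mem_supported hb (v := Function.update v i LinearMap.id),
    LinearMap.mem_ker.1 hb0, map_zero]
  intro j hj
  by_cases hji : j = i
  · subst hji; simp
  · rw [Function.update_of_ne hji]
    exact h j (hj.resolve_left hji)

/-- If `v` factors through the module presented by `(D, P)`, then gluing extends the pair: it
appends to that module, along `v`, a copy of `T`. -/
theorem le_gluing (hi : i ∉ D) {P : Submodule R (ι →₀ T)} (hPD : P ≤ Finsupp.supported T R D)
    (hPv : ∀ b ∈ P, sumMap v b = 0) : P ≤ gluing D v i := fun b hb =>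
  mem_gluing.2 ⟨Finsupp.supported_mono (Set.subset_insert i D) (hPD hb), by
    rw [sumMap_update_of_mem_supported hi (hPD hb), hPv b hb]⟩

end Gluing

/-- Pairs `(D, P)` presenting a module over `M` as a pure quotient of the sum of the copies of `T`
indexed by `D`. -/
structure IsPurePresentation (f : T →ₗ[R] M) (z : Set ι × Submodule R (ι →₀ T)) : Prop where
  le_supported : z.2 ≤ Finsupp.supported T R z.1
  le_ker : z.2 ≤ LinearMap.ker (foldMap ι f)
  pure : IsPureIn z.2 (Finsupp.supported T R z.1)

/-- The union of a chain of pairs. -/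
noncomputable def chainUnion (c : Set (Set ι × Submodule R (ι →₀ T))) :
    Set ι × Submodule R (ι →₀ T) :=
  (⋃ z ∈ c, z.1, sSup (Prod.snd '' c))

theorem le_chainUnion {c : Set (Set ι × Submodule R (ι →₀ T))} {z} (hz : z ∈ c) :
    z ≤ chainUnion c :=
  ⟨Set.subset_biUnion_of_mem (u := fun z : Set ι × Submodule R (ι →₀ T) => z.1) hz,
    le_sSup ⟨z, hz, rfl⟩⟩

section Chain

variable {c : Set (Set ι × Submodule R (ι →₀ T))}

theorem mem_chainUnion_snd (hc : IsChain (· ≤ ·) c) (hne : c.Nonempty) {b : ι →₀ T} :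
    b ∈ (chainUnion c).2 ↔ ∃ z ∈ c, b ∈ z.2 := by
  have hdir : DirectedOn (· ≤ ·) (Prod.snd '' c) :=
    (hc.directedOn.mono_comp (g := Prod.snd) fun _ _ h => h.2)
  simp only [chainUnion]
  rw [Submodule.mem_sSup_of_directed (hne.image _) hdir, Set.exists_mem_image]

/-- Finitely many conditions which persist and each hold somewhere in the chain hold together. -/
theorem exists_mem_chain_forall (hc : IsChain (· ≤ ·) c) (hne : c.Nonempty)
    {κ : Type*} [Finite κ]
    (p : κ → Set ι × Submodule R (ι →₀ T) → Prop) (hp : ∀ k z z', z ≤ z' → p k z → p k z')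
    (h : ∀ k, ∃ z ∈ c, p k z) : ∃ z ∈ c, ∀ k, p k z := by
  classical
  have := Fintype.ofFinite κ
  choose z hz hpz using h
  have : Nonempty c := hne.to_subtype
  obtain ⟨w, hw⟩ := hc.directedOn.directed_val.finset_le
    (Finset.univ.image fun k => (⟨z k, hz k⟩ : c))
  exact ⟨w, w.2, fun k => hp k _ _
    (hw ⟨z k, hz k⟩ (Finset.mem_image_of_mem _ (Finset.mem_univ k))) (hpz k)⟩

theorem exists_mem_supported_of_chainUnion (hc : IsChain (· ≤ ·) c) (hne : c.Nonempty)
    {b : ι →₀ T}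
    (hb : b ∈ Finsupp.supported T R (chainUnion c).1) :
    ∃ z ∈ c, b ∈ Finsupp.supported T R z.1 := by
  rw [Finsupp.mem_supported] at hb
  obtain ⟨z, hz, hzb⟩ := exists_mem_chain_forall hc hne (κ := b.support)
    (fun k z => (k : ι) ∈ z.1) (fun k z z' hzz' hk => hzz'.1 hk) fun k => by
      have := hb k.2
      simpa [chainUnion] using this
  exact ⟨z, hz, (Finsupp.mem_supported R b).2 fun k hk => hzb ⟨k, hk⟩⟩

/-- A finite system involves finitely many unknowns of finite support and finitely many right-hand
sides, so it already lives in one member of the chain. This is how direct limits are kept inside the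
class. -/
theorem isPurePresentation_chainUnion (hc : IsChain (· ≤ ·) c) (hne : c.Nonempty)
    {f : T →ₗ[R] M} (h : ∀ z ∈ c, IsPurePresentation f z) :
    IsPurePresentation f (chainUnion c) where
  le_supported := by
    intro b hb
    obtain ⟨z, hz, hbz⟩ := (mem_chainUnion_snd hc hne).1 hb
    exact Finsupp.supported_mono (le_chainUnion hz).1 ((h z hz).le_supported hbz)
  le_ker := by
    intro b hb
    obtain ⟨z, hz, hbz⟩ := (mem_chainUnion_snd hc hne).1 hb
    exact (h z hz).le_ker hbz
  pure := by
    intro m n A x hxD hx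
    obtain ⟨z, hz, hzx⟩ := exists_mem_chain_forall hc hne (κ := Fin n ⊕ Fin m)
      (fun k z => Sum.elim (fun j => x j ∈ Finsupp.supported T R z.1)
        (fun i => ∑ j, A i j • x j ∈ z.2) k)
      (by
        rintro (j | i) z z' hzz' hk
        · exact Finsupp.supported_mono hzz'.1 hk
        · exact hzz'.2 hk)
      (by
        rintro (j | i)
        · exact exists_mem_supported_of_chainUnion hc hne (hxD j)
        · exact (mem_chainUnion_snd hc hne).1 (hx i))
    obtain ⟨y, hy, hyx⟩ := (h z hz).pure m n A x (fun j => hzx (.inl j)) fun i => hzx (.inr i)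
    exact ⟨y, fun j => (le_chainUnion hz).2 (hy j), hyx⟩

end Chain

theorem IsPurePresentation.gluing [DecidableEq ι] {f : T →ₗ[R] M} {D : Set ι}
    {v : ι → T →ₗ[R] T} {i : ι} (h : ∀ j ∈ D, f ∘ₗ v j = f) :
    IsPurePresentation f (insert i D, gluing D v i) :=
  ⟨inf_le_left, gluing_le_ker h, isPureIn_gluing⟩

variable {𝓕 : ObjectProperty (ModuleCat.{u} R)}

/-- `f : T → M` is an `𝓕`-precover, for unbundled modules. -/
def IsLinearPrecover (𝓕 : ObjectProperty (ModuleCat.{u} R)) (f : T →ₗ[R] M) : Prop :=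
  𝓕 (.of R T) ∧ ∀ (F : Type u) [AddCommGroup F] [Module R F] (g : F →ₗ[R] M),
    𝓕 (.of R F) → ∃ k : F →ₗ[R] T, f ∘ₗ k = g

/-- The module presented by a pair `(D, P)`. -/
abbrev Presented (z : Set ι × Submodule R (ι →₀ T)) : Type u :=
  Finsupp.supported T R z.1 ⧸ z.2.submoduleOf (Finsupp.supported T R z.1)

/-- The structure map to `M` of the module presented by `(D, P)`. -/
noncomputable def IsPurePresentation.desc {f : T →ₗ[R] M} {z : Set ι × Submodule R (ι →₀ T)}
    (hz : IsPurePresentation f z) : Presented z →ₗ[R] M :=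
  Submodule.liftQ _ (foldMap ι f ∘ₗ (Finsupp.supported T R z.1).subtype) fun _ hb => hz.le_ker hb

theorem IsPurePresentation.desc_mkQ {f : T →ₗ[R] M} {z : Set ι × Submodule R (ι →₀ T)}
    (hz : IsPurePresentation f z) (b : Finsupp.supported T R z.1) :
    hz.desc (Submodule.mkQ _ b) = foldMap ι f b := rfl

theorem IsPurePresentation.mem (h𝓕 : IsPurityClosed 𝓕) {f : T →ₗ[R] M}
    {z : Set ι × Submodule R (ι →₀ T)} (hz : IsPurePresentation f z) (hT : 𝓕 (.of R T)) :
    𝓕 (.of R (Presented z)) :=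
  h𝓕.pure_quotient _ (h𝓕.supported hT z.1) (hz.pure.isPure_submoduleOf hz.le_supported)

/-- A map over `M` from the presented module to `T`, as a family of endomorphisms of `T`. -/
theorem IsPurePresentation.exists_family {f : T →ₗ[R] M} {z : Set ι × Submodule R (ι →₀ T)}
    (hz : IsPurePresentation f z) (k : Presented z →ₗ[R] T) (hk : f ∘ₗ k = hz.desc) :
    ∃ v : ι → T →ₗ[R] T, (∀ j ∈ z.1, f ∘ₗ v j = f) ∧
      ∀ b : Finsupp.supported T R z.1, sumMap v b = k (Submodule.mkQ _ b) := by
  classical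
  -- Projection onto the summands in `D`; the family is zero outside `D`.
  let π : (ι →₀ T) →ₗ[R] Finsupp.supported T R z.1 := Finsupp.restrictDom T R z.1
  have hπ : ∀ b : Finsupp.supported T R z.1, π b = b := fun b =>
    LinearMap.congr_fun (Finsupp.restrictDom_comp_subtype (M := T) (R := R) z.1) b
  refine ⟨fun j => k ∘ₗ Submodule.mkQ _ ∘ₗ π ∘ₗ Finsupp.lsingle j, fun j hj => ?_, fun b => ?_⟩
  · ext t
    have := hπ ⟨Finsupp.single j t, Finsupp.single_mem_supported R t hj⟩
    simp only [LinearMap.comp_apply, Finsupp.lsingle_apply]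
    rw [this]
    refine (LinearMap.congr_fun hk _).trans ((hz.desc_mkQ _).trans ?_)
    simp
  · have : sumMap (fun j => k ∘ₗ Submodule.mkQ _ ∘ₗ π ∘ₗ Finsupp.lsingle j) =
        k ∘ₗ Submodule.mkQ _ ∘ₗ π := by
      ext j t; simp
    rw [this]
    simp only [LinearMap.comp_apply, hπ]

/-- The presented module is a pure quotient of a direct sum of copies of `T`, hence in the class, so
its map to `M` factors through the precover. -/
theorem IsPurePresentation.exists_sumMap (h𝓕 : IsPurityClosed 𝓕) {f : T →ₗ[R] M}
    (hf : IsLinearPrecover 𝓕 f) {z : Set ι × Submodule R (ι →₀ T)}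
    (hz : IsPurePresentation f z) :
    ∃ v : ι → T →ₗ[R] T, (∀ j ∈ z.1, f ∘ₗ v j = f) ∧ ∀ b ∈ z.2, sumMap v b = 0 := by
  obtain ⟨k, hk⟩ := hf.2 _ hz.desc (hz.mem h𝓕 hf.1)
  obtain ⟨v, hv, hvk⟩ := hz.exists_family k hk
  refine ⟨v, hv, fun b hb => ?_⟩
  have h1 := hvk ⟨b, hz.le_supported hb⟩
  have h2 : Submodule.mkQ (z.2.submoduleOf (Finsupp.supported T R z.1))
      ⟨b, hz.le_supported hb⟩ = 0 := (Submodule.Quotient.mk_eq_zero _).2 hb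
  rw [h2, map_zero] at h1
  exact h1

/-- Provides every element of a direct sum of copies of `T` with its own index, so that each element
to be killed has a summand reserved for it. -/
theorem exists_injective_option_finsupp (T : Type u) [AddCommGroup T] :
    ∃ (I : Type u) (l : (Option I →₀ T) → I), Function.Injective l := by
  let I : Type u := ℕ ⊕ T
  suffices h : Cardinal.mk (Option I →₀ T) ≤ Cardinal.mk I from ⟨I, h.some, h.some.injective⟩
  have hI : Cardinal.mk (Option I) = Cardinal.mk I := by
    rw [Cardinal.mk_option, Cardinal.add_one_eq (Cardinal.aleph0_le_mk I)]
  have hT : Cardinal.mk T ≤ Cardinal.mk I := Cardinal.mk_le_of_injective Sum.inr_injective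
  rcases subsingleton_or_nontrivial T with h | h
  · exact (Cardinal.le_one_iff_subsingleton.2 inferInstance).trans
      (Cardinal.one_le_aleph0.trans (Cardinal.aleph0_le_mk I))
  · rw [Cardinal.mk_finsupp_of_infinite, hI]
    exact max_le le_rfl hT

/-- A precovering class closed under purity constructions has precovers all of whose endomorphisms
are injective. -/
theorem exists_precover_endomorphisms_injective (h𝓕 : IsPurityClosed 𝓕) {f : T →ₗ[R] M}
    (hf : IsLinearPrecover 𝓕 f) :
    ∃ (G : Type u) (_ : AddCommGroup G) (_ : Module R G) (p : G →ₗ[R] M),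
      IsLinearPrecover 𝓕 p ∧ ∀ g : G →ₗ[R] G, p ∘ₗ g = p → Function.Injective g := by
  classical
  obtain ⟨I, l, hl⟩ := exists_injective_option_finsupp T
  -- The summand `none` keeps a copy of `T`, through which the result is again a precover. A summand
  -- `some i` may be used only once the element labelled `i` has been killed.
  let Z : Set (Set (Option I) × Submodule R (Option I →₀ T)) :=
    {z | IsPurePresentation f z ∧ none ∈ z.1 ∧ ∀ i, some i ∈ z.1 → ∃ b ∈ z.2, l b = i}
  obtain ⟨z, -, hz⟩ := zorn_le_nonempty₀ Z (by
    intro c hcZ hc y hy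
    refine ⟨chainUnion c, ⟨isPurePresentation_chainUnion hc ⟨y, hy⟩ fun z hz => (hcZ hz).1,
      (le_chainUnion hy).1 (hcZ hy).2.1, fun i hi => ?_⟩, fun z hz => le_chainUnion hz⟩
    obtain ⟨z, hz, hiz⟩ := Set.mem_iUnion₂.1 hi
    obtain ⟨b, hb, rfl⟩ := (hcZ hz).2.2 i hiz
    exact ⟨b, (le_chainUnion hz).2 hb, rfl⟩) ({none}, ⊥)
    ⟨⟨bot_le, bot_le, fun m n A x _ hx =>
      ⟨0, fun _ => rfl, fun i => by simpa using (hx i : _ = _).symm⟩⟩, rfl, by simp⟩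
  obtain ⟨hzp, hz0, hzl⟩ := hz.prop
  -- Every map over `M` from the maximal presented module to `T` is injective: if it killed the
  -- class of some `b ∉ P`, the index labelled by `b` would still be free, and gluing there would
  -- enlarge the pair.
  have hinj : ∀ v : Option I → T →ₗ[R] T, (∀ j ∈ z.1, f ∘ₗ v j = f) →
      (∀ b ∈ z.2, sumMap v b = 0) → ∀ b ∈ Finsupp.supported T R z.1, sumMap v b = 0 → b ∈ z.2 := by
    intro v hv hvP b hb hvb
    by_contra hbP
    have hi : some (l b) ∉ z.1 := fun h => by
      obtain ⟨b', hb', hbb'⟩ := hzl _ h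
      exact hbP (hl hbb' ▸ hb')
    have hle : z ≤ (insert (some (l b)) z.1, gluing z.1 v (some (l b))) :=
      ⟨Set.subset_insert _ _, le_gluing hi hzp.le_supported hvP⟩
    have hmem : (insert (some (l b)) z.1, gluing z.1 v (some (l b))) ∈ Z := by
      refine ⟨.gluing hv, Or.inr hz0, fun i hi' => ?_⟩
      rcases hi' with hi' | hi'
      · refine ⟨b, mem_gluing.2 ⟨Finsupp.supported_mono (Set.subset_insert _ _) hb, ?_⟩,
          (Option.some_injective _ hi').symm⟩
        rw [sumMap_update_of_mem_supported hi hb, hvb]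
      · obtain ⟨b', hb', h⟩ := hzl i hi'
        exact ⟨b', hle.2 hb', h⟩
    exact hi ((hz.le_of_ge hmem hle).1 (Set.mem_insert _ _))
  refine ⟨Presented z, inferInstance, inferInstance, hzp.desc, ⟨hzp.mem h𝓕 hf.1,
    fun F _ _ g hF => ?_⟩, fun g hg => ?_⟩
  · obtain ⟨k, hk⟩ := hf.2 F g hF
    let j : T →ₗ[R] Finsupp.supported T R z.1 := (Finsupp.lsingle none).codRestrict _ fun t =>
      Finsupp.single_mem_supported R t hz0
    refine ⟨Submodule.mkQ _ ∘ₗ j ∘ₗ k, ?_⟩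
    ext x
    rw [← hk]
    refine (hzp.desc_mkQ _).trans ?_
    change foldMap _ f (Finsupp.single none (k x)) = f (k x)
    simp
  -- Composing `g` with a map `k` to `T` over `M` gives such a map, and injectivity of `k ∘ₗ g`
  -- implies that of `g`.
  · obtain ⟨k, hk⟩ := hf.2 _ hzp.desc (hzp.mem h𝓕 hf.1)
    obtain ⟨v, hv, hvk⟩ := hzp.exists_family (k ∘ₗ g) (by rw [← LinearMap.comp_assoc, hk, hg])
    have hmk : ∀ b : Finsupp.supported T R z.1,
        Submodule.mkQ (z.2.submoduleOf (Finsupp.supported T R z.1)) b = 0 ↔ (b : _ →₀ T) ∈ z.2 :=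
      fun b => Submodule.Quotient.mk_eq_zero _
    rw [← LinearMap.ker_eq_bot, LinearMap.ker_eq_bot']
    intro x hx
    obtain ⟨b, rfl⟩ := Submodule.mkQ_surjective _ x
    refine (hmk b).2 (hinj v hv (fun b' hb' => ?_) b b.2 ?_)
    · rw [hvk ⟨b', hzp.le_supported hb'⟩, (hmk _).2 hb', map_zero]
    · rw [hvk, LinearMap.comp_apply, hx, map_zero]

/-- A precover all of whose endomorphisms are injective is a cover. -/
theorem endomorphisms_bijective_of_injective (h𝓕 : IsPurityClosed 𝓕) {f : T →ₗ[R] M}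
    (hf : IsLinearPrecover 𝓕 f)
    (hinj : ∀ g : T →ₗ[R] T, f ∘ₗ g = f → Function.Injective g) (g : T →ₗ[R] T)
    (hg : f ∘ₗ g = f) : Function.Bijective g := by
  classical
  -- More indices than elements of `T`, so a strictly growing chain inside `T` cannot exhaust them.
  let I : Type u := Set T
  let r : I → I → Prop := WellOrderingRel
  -- The indices used form an initial segment, each summand contributes an element not coming from
  -- the earlier ones, and every map over `M` from the presented module to `T` is injective.
  let Z : Set (Set I × Submodule R (I →₀ T)) := {z | IsPurePresentation f z ∧
    (∀ j ∈ z.1, ∀ k, r k j → k ∈ z.1) ∧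
    (∀ j ∈ z.1, ∃ t : T, ∀ b ∈ Finsupp.supported T R {k | r k j}, Finsupp.single j t - b ∉ z.2) ∧
    ∀ v : I → T →ₗ[R] T, (∀ j ∈ z.1, f ∘ₗ v j = f) → (∀ b ∈ z.2, sumMap v b = 0) →
      ∀ b ∈ Finsupp.supported T R z.1, sumMap v b = 0 → b ∈ z.2}
  have hlower : ∀ z ∈ Z, ∀ j ∈ z.1, ∀ t : T, ∀ b ∈ Finsupp.supported T R {k | r k j},
      Finsupp.single j t - b ∈ Finsupp.supported T R z.1 := fun z hz j hj t b hb =>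
    Submodule.sub_mem _ (Finsupp.single_mem_supported R t hj)
      (Finsupp.supported_mono (fun k hk => hz.2.1 j hj k hk) hb)
  -- The second condition makes the presented modules embed in one another; without it, the new
  -- elements contributed by the summands might not remain new in the union of a chain.
  let s : Z → Z → Prop := fun z z' => z.1 ≤ z'.1 ∧
    ∀ b ∈ Finsupp.supported T R z.1.1, b ∈ z'.1.2 → b ∈ z.1.2
  obtain ⟨⟨z, hzZ⟩, hmax⟩ := exists_maximal_of_chains_bounded (r := s) (by
    intro C hC
    rcases C.eq_empty_or_nonempty with rfl | hne
    · refine ⟨⟨(∅, ⊥), ⟨bot_le, bot_le, fun m n A x _ hx =>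
        ⟨0, fun _ => rfl, fun i => by simpa using (hx i : _ = _).symm⟩⟩, by simp, by simp, ?_⟩,
        by simp⟩
      intro v _ _ b hb _
      simpa using hb
    let c := Subtype.val '' C
    have hc : IsChain (· ≤ ·) c := by
      rintro _ ⟨x, hx, rfl⟩ _ ⟨y, hy, rfl⟩ hxy
      exact (hC hx hy fun h => hxy (h ▸ rfl)).imp And.left And.left
    have hcne : c.Nonempty := hne.image _
    have hcZ : ∀ z ∈ c, z ∈ Z := by
      rintro _ ⟨x, -, rfl⟩
      exact x.2
    have hcoh : ∀ z ∈ c, ∀ b ∈ Finsupp.supported T R z.1, b ∈ (chainUnion c).2 → b ∈ z.2 := by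
      rintro _ ⟨x, hx, rfl⟩ b hb hbc
      obtain ⟨_, ⟨y, hy, rfl⟩, hby⟩ := (mem_chainUnion_snd hc hcne).1 hbc
      rcases eq_or_ne x y with rfl | hxy
      · exact hby
      rcases hC hx hy hxy with h | h
      · exact h.2 b hb hby
      · exact h.1.2 hby
    have hmem : chainUnion c ∈ Z := by
      refine ⟨isPurePresentation_chainUnion hc hcne fun z hz => (hcZ z hz).1, fun j hj k hk => ?_,
        fun j hj => ?_, fun v hv hvP b hb hvb => ?_⟩
      · obtain ⟨z, hz, hjz⟩ := Set.mem_iUnion₂.1 hj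
        exact (le_chainUnion hz).1 ((hcZ z hz).2.1 j hjz k hk)
      · obtain ⟨z, hz, hjz⟩ := Set.mem_iUnion₂.1 hj
        obtain ⟨t, ht⟩ := (hcZ z hz).2.2.1 j hjz
        exact ⟨t, fun b hb h => ht b hb (hcoh z hz _ (hlower z (hcZ z hz) j hjz t b hb) h)⟩
      · obtain ⟨z, hz, hbz⟩ := exists_mem_supported_of_chainUnion hc hcne hb
        exact (le_chainUnion hz).2 ((hcZ z hz).2.2.2 v (fun j hj => hv j ((le_chainUnion hz).1 hj))
          (fun b hb => hvP b ((le_chainUnion hz).2 hb)) b hbz hvb)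
    exact ⟨⟨chainUnion c, hmem⟩, fun x hx =>
      ⟨le_chainUnion ⟨x, hx, rfl⟩, hcoh _ ⟨x, hx, rfl⟩⟩⟩)
    (fun {a b c} hab hbc => ⟨hab.1.trans hbc.1, fun x hx hxc =>
      hab.2 x hx (hbc.2 x (Finsupp.supported_mono hab.1.1 hx) hxc)⟩)
  obtain ⟨hzp, hzlow, hzt, hzinj⟩ := id hzZ
  obtain ⟨v, hv, hvP⟩ := hzp.exists_sumMap h𝓕 hf
  -- Otherwise the new elements, one for each index, would have distinct images in `T` under an
  -- injective map, and `Set T` would inject into `T`.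
  have hnot : ∃ i, i ∉ z.1 := by
    by_contra! hall
    choose t ht using fun j => hzt j (hall j)
    refine Function.cantor_injective (fun j => sumMap v (Finsupp.single j (t j))) ?_
    have key : ∀ j k, r k j →
        sumMap v (Finsupp.single j (t j)) ≠ sumMap v (Finsupp.single k (t k)) := by
      intro j k hkj h
      have hb : Finsupp.single k (t k) ∈ Finsupp.supported T R {k | r k j} :=
        Finsupp.single_mem_supported R _ hkj
      exact ht j _ hb (hzinj v hv hvP _ (hlower z hzZ j (hall j) _ _ hb)
        (by rw [map_sub, h, sub_self]))
    intro j k hjk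
    rcases trichotomous_of r j k with h | h | h
    · exact absurd hjk.symm (key k j h)
    · exact h
    · exact absurd hjk (key j k h)
  have hwf : WellFounded r := IsWellFounded.wf
  let i := hwf.min {i | i ∉ z.1} hnot
  have hi : i ∉ z.1 := hwf.min_mem {i | i ∉ z.1} hnot
  have hilow : ∀ k, r k i → k ∈ z.1 := fun k hk => by
    by_contra h
    exact hwf.not_lt_min {i | i ∉ z.1} h hk
  -- If `t` were not in the image, gluing `T` along `v` at the first free index `i` would contribute
  -- the new element `t` and contradict maximality.
  have hsurj : ∀ v : I → T →ₗ[R] T, (∀ j ∈ z.1, f ∘ₗ v j = f) → (∀ b ∈ z.2, sumMap v b = 0) →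
      ∀ t, ∃ b ∈ Finsupp.supported T R z.1, sumMap v b = t := by
    intro v hv hvP t
    by_contra! ht
    have hcoh : ∀ b ∈ Finsupp.supported T R z.1, b ∈ gluing z.1 v i → b ∈ z.2 := by
      intro b hb hbv
      refine hzinj v hv hvP b hb ?_
      rw [← sumMap_update_of_mem_supported hi hb]
      exact (mem_gluing.1 hbv).2
    have hmem : (insert i z.1, gluing z.1 v i) ∈ Z := by
      refine ⟨.gluing hv, ?_, ?_, ?_⟩
      · rintro j (rfl | hj) k hk
        · exact Or.inr (hilow k hk)
        · exact Or.inr (hzlow j hj k hk)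
      · rintro j (rfl | hj)
        · refine ⟨t, fun b hb h => ht b (Finsupp.supported_mono hilow hb) ?_⟩
          have := (mem_gluing.1 h).2
          rw [map_sub, sumMap_update_single, sub_eq_zero,
            sumMap_update_of_mem_supported hi (Finsupp.supported_mono hilow hb)] at this
          exact this.symm
        · obtain ⟨t, ht⟩ := hzt j hj
          exact ⟨t, fun b hb h => ht b hb (hcoh _ (hlower z hzZ j hj t b hb) h)⟩
      · intro w hw hwP b hb hwb
        have hsub := sub_single_mem_gluing (v := v) hb
        have h1 := hwP _ hsub
        rw [map_sub, hwb, zero_sub, neg_eq_zero] at h1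
        refine mem_gluing.2 ⟨hb, ?_⟩
        -- Modulo the gluing every element is equivalent to one of the summand `i`, where `w` acts
        -- as an endomorphism of `T` over `M`; here the injectivity hypothesis enters.
        have h2 := hinj (w i) (hw i (Set.mem_insert _ _))
        refine h2 ?_
        rw [map_zero, ← h1]
        simp
    exact hi ((hmax ⟨_, hmem⟩ ⟨⟨Set.subset_insert _ _, le_gluing hi hzp.le_supported hvP⟩,
      hcoh⟩).1.1 (Set.mem_insert _ _))
  refine ⟨hinj g hg, fun t => ?_⟩
  have hcomp : sumMap (fun j => g ∘ₗ v j) = g ∘ₗ sumMap v := by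
    ext j x; simp
  -- Surjectivity for the family `g ∘ₗ v` yields surjectivity of `g`.
  obtain ⟨b, -, hb⟩ := hsurj (fun j => g ∘ₗ v j)
    (fun j hj => by rw [← LinearMap.comp_assoc, hg, hv j hj])
    (fun b hb => by rw [hcomp, LinearMap.comp_apply, hvP b hb, map_zero]) t
  exact ⟨_, (LinearMap.congr_fun hcomp b).symm.trans hb⟩

theorem IsPurityClosed.isCovering (h : IsPurityClosed 𝓕) : IsCovering 𝓕 := by
  intro M
  obtain ⟨T, _, _, f, hf⟩ := h.exists_precover M
  obtain ⟨G, _, _, p, hp, hinj⟩ := exists_precover_endomorphisms_injective h hf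
  refine ⟨.of R G, ModuleCat.ofHom p, ⟨hp.1, fun F' hF' g => ?_⟩, fun g hg => ?_⟩
  · obtain ⟨k, hk⟩ := hp.2 F' g.hom hF'
    exact ⟨ModuleCat.ofHom k, ModuleCat.hom_ext hk⟩
  · have hb := endomorphisms_bijective_of_injective h hp hinj g.hom (congrArg ModuleCat.Hom.hom hg)
    exact (LinearEquiv.ofBijective g.hom hb).toModuleIso.isIso_hom

end Cover

/-! ### Finite `n`-presentations through projective resolutions -/

section Presentations

variable (R : Type u) [Ring R]

/-- `M` has a partial resolution of length `n` by finitely generated projective modules. -/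
def ProjPresented : ℕ → ∀ (M : Type u) [AddCommGroup M] [Module R M], Prop
  | 0, M, _, _ => Module.Finite R M
  | n + 1, M, _, _ => ∃ (K P : ModuleCat.{u} R) (i : K →ₗ[R] P) (p : P →ₗ[R] M),
      (Module.Finite R P ∧ Module.Projective R P) ∧ Function.Injective i ∧ Function.Exact i p ∧
        Function.Surjective p ∧ ProjPresented n K

variable {R} {A B C : Type u} [AddCommGroup A] [Module R A] [AddCommGroup B] [Module R B]
  [AddCommGroup C] [Module R C]

theorem ProjPresented.of_equiv {n : ℕ} (e : A ≃ₗ[R] B) (h : ProjPresented R n A) :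
    ProjPresented R n B := by
  cases n with
  | zero => exact @Module.Finite.equiv R A B _ _ _ _ _ h e
  | succ n =>
    obtain ⟨K, P, i, p, hP, hi, hip, hp, hK⟩ := h
    refine ⟨K, P, i, (e : A →ₗ[R] B) ∘ₗ p, hP, hi, fun x => ?_, e.surjective.comp hp, hK⟩
    rw [← hip x]
    simp

/-- Factor a map through an injective map with the same kernel condition. -/
theorem exists_linearMap_of_exact {D : Type u} [AddCommGroup D] [Module R D] {i : A →ₗ[R] B}
    {p : B →ₗ[R] C} (hi : Function.Injective i) (hip : Function.Exact i p) (g : D →ₗ[R] B)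
    (hg : ∀ x, p (g x) = 0) : ∃ k : D →ₗ[R] A, ∀ x, i (k x) = g x := by
  refine ⟨(LinearEquiv.ofInjective i hi).symm ∘ₗ g.codRestrict (LinearMap.range i) fun x =>
    (hip _).1 (hg x), fun x => ?_⟩
  have := congrArg Subtype.val ((LinearEquiv.ofInjective i hi).apply_symm_apply
    (g.codRestrict (LinearMap.range i) (fun x => (hip _).1 (hg x)) x))
  exact this

/-- Horseshoe lemma: `P' → C` lifts to `B`, so `P × P'` maps onto `B`, and the kernel is an
extension of `K'` by `K`. -/
theorem ProjPresented.of_extension {n : ℕ} {A B C : Type u} [AddCommGroup A] [Module R A]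
    [AddCommGroup B] [Module R B] [AddCommGroup C] [Module R C] {i : A →ₗ[R] B} {p : B →ₗ[R] C}
    (hi : Function.Injective i) (hip : Function.Exact i p) (hp : Function.Surjective p)
    (hA : ProjPresented R n A) (hC : ProjPresented R n C) : ProjPresented R n B := by
  induction n generalizing A B C with
  | zero =>
    have : Module.Finite R A := hA
    have : Module.Finite R C := hC
    have h1 : (LinearMap.ker p).FG := by
      rw [hip.linearMap_ker_eq]
      exact Submodule.FG.of_finite
    refine ⟨Submodule.fg_of_fg_map_of_fg_inf_ker p ?_ (by simpa using h1)⟩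
    rw [Submodule.map_top, LinearMap.range_eq_top.2 hp]
    exact Module.Finite.fg_top
  | succ n ih =>
    obtain ⟨K, P, j, q, ⟨_, _⟩, hj, hjq, hq, hK⟩ := hA
    obtain ⟨K', P', j', q', ⟨_, _⟩, hj', hjq', hq', hK'⟩ := hC
    obtain ⟨l, hl⟩ := Module.projective_lifting_property p q' hp
    have hl' : ∀ y, p (l y) = q' y := fun y => LinearMap.congr_fun hl y
    have hpi : ∀ a, p (i a) = 0 := hip.apply_apply_eq_zero
    let φ : P × P' →ₗ[R] B := (i ∘ₗ q).coprod l
    obtain ⟨s, hs⟩ := exists_linearMap_of_exact hj' hjq'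
      (LinearMap.snd R P P' ∘ₗ (LinearMap.ker φ).subtype) fun x => by
        have : p (i (q x.1.1) + l x.1.2) = 0 :=
          (congrArg p (LinearMap.mem_ker.1 x.2)).trans (map_zero p)
        simpa [hl', hpi] using this
    let t : K →ₗ[R] LinearMap.ker φ := ((LinearMap.inl R P P') ∘ₗ j).codRestrict _ fun x => by
      simp [φ, hjq.apply_apply_eq_zero]
    have hKφ : ProjPresented R n (LinearMap.ker φ) := by
      refine ih (i := t) (p := s) ?_ ?_ ?_ hK hK'
      · intro x y hxy
        exact hj (congrArg (fun z => z.1.1) hxy)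
      · intro x
        constructor
        · intro hx
          have h2 : x.1.2 = 0 := by
            have := hs x
            rw [hx, map_zero] at this
            exact this.symm
          have h1 : i (q x.1.1) = 0 := by
            have : i (q x.1.1) + l x.1.2 = 0 := LinearMap.mem_ker.1 x.2
            simpa [h2] using this
          have h3 : q x.1.1 = 0 := hi (by rw [h1, map_zero])
          obtain ⟨k, hk⟩ := (hjq _).1 h3
          exact ⟨k, Subtype.ext (Prod.ext hk h2.symm)⟩
        · rintro ⟨k, rfl⟩
          apply hj'
          rw [hs, map_zero]
          rfl
      · intro k
        have h1 : p (l (j' k)) = 0 := by rw [hl', hjq'.apply_apply_eq_zero]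
        obtain ⟨a, ha⟩ := (hip _).1 h1
        obtain ⟨x, rfl⟩ := hq a
        refine ⟨⟨(-x, j' k), ?_⟩, ?_⟩
        · simp [φ, ha]
        · apply hj'
          rw [hs]
          rfl
    refine ⟨.of R (LinearMap.ker φ), .of R (P × P'), (LinearMap.ker φ).subtype, φ,
      ⟨inferInstanceAs (Module.Finite R (P × P')), inferInstanceAs (Module.Projective R (P × P'))⟩,
      Subtype.val_injective, fun x => ?_, ?_, hKφ⟩
    · exact ⟨fun h => ⟨⟨x, h⟩, rfl⟩, by rintro ⟨y, rfl⟩; exact y.2⟩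
    · intro b
      obtain ⟨y, hy⟩ := hq' (p b)
      obtain ⟨a, ha⟩ := (hip (b - l y)).1 (by rw [map_sub, hl', hy, sub_self])
      obtain ⟨x, rfl⟩ := hq a
      exact ⟨(x, y), by simp [φ, ha]⟩

/-- The kernel of `p ∘ₗ f` is the preimage of `A` in `P`, hence an extension of `A` by the kernel of
`f`. -/
theorem ProjPresented.ker_comp {n : ℕ} {P : Type u} [AddCommGroup P] [Module R P]
    {i : A →ₗ[R] B} {p : B →ₗ[R] C} (hi : Function.Injective i) (hip : Function.Exact i p)
    {f : P →ₗ[R] B} (hf : Function.Surjective f) (hA : ProjPresented R n A)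
    (hK : ProjPresented R n (LinearMap.ker f)) : ProjPresented R n (LinearMap.ker (p ∘ₗ f)) := by
  obtain ⟨s, hs⟩ := exists_linearMap_of_exact hi hip (f ∘ₗ (LinearMap.ker (p ∘ₗ f)).subtype)
    fun x => x.2
  have hle : LinearMap.ker f ≤ LinearMap.ker (p ∘ₗ f) := LinearMap.ker_le_ker_comp f p
  refine .of_extension (i := Submodule.inclusion hle) (p := s) (Submodule.inclusion_injective hle)
    (fun x => ?_) (fun a => ?_) hK hA
  · constructor
    · intro hx
      have := hs x
      rw [hx, map_zero] at this
      exact ⟨⟨x, this.symm⟩, rfl⟩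
    · rintro ⟨y, rfl⟩
      apply hi
      rw [hs, map_zero]
      exact y.2
  · obtain ⟨x, hx⟩ := hf (i a)
    refine ⟨⟨x, ?_⟩, ?_⟩
    · simp [hx, hip.apply_apply_eq_zero]
    · apply hi
      rw [hs]
      exact hx

theorem exact_subtype_ker (f : A →ₗ[R] B) : Function.Exact (LinearMap.ker f).subtype f :=
  fun x => ⟨fun h => ⟨⟨x, h⟩, rfl⟩, by rintro ⟨y, rfl⟩; exact y.2⟩

theorem ProjPresented.of_cokernel {n : ℕ} {i : A →ₗ[R] B} {p : B →ₗ[R] C}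
    (hi : Function.Injective i) (hip : Function.Exact i p) (hp : Function.Surjective p)
    (hA : ProjPresented R n A) (hB : ProjPresented R (n + 1) B) : ProjPresented R (n + 1) C := by
  obtain ⟨K, P, j, q, hP, hj, hjq, hq, hK⟩ := hB
  have hK' : ProjPresented R n (LinearMap.ker q) := by
    refine hK.of_equiv ((LinearEquiv.ofInjective j hj).trans (LinearEquiv.ofEq _ _ ?_))
    exact hjq.linearMap_ker_eq.symm
  exact ⟨.of R (LinearMap.ker (p ∘ₗ q)), P, (LinearMap.ker (p ∘ₗ q)).subtype, p ∘ₗ q, hP,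
    Subtype.val_injective, exact_subtype_ker _, hp.comp hq, .ker_comp hi hip hq hA hK'⟩

theorem ProjPresented.of_projective (n : ℕ) (P : Type u) [AddCommGroup P] [Module R P]
    [Module.Finite R P] [Module.Projective R P] : ProjPresented R n P := by
  induction n generalizing P with
  | zero => exact inferInstanceAs (Module.Finite R P)
  | succ n ih =>
    refine ⟨.of R PUnit, .of R P, 0, LinearMap.id, ⟨inferInstanceAs (Module.Finite R P),
      inferInstanceAs (Module.Projective R P)⟩, Function.injective_of_subsingleton _, fun x => ?_,
      Function.surjective_id, ih PUnit⟩
    simp [eq_comm]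

theorem ProjPresented.pi {n : ℕ} (h : ProjPresented R n A) (k : ℕ) :
    ProjPresented R n (Fin k → A) := by
  induction k with
  | zero => exact .of_projective n _
  | succ k ih =>
    refine .of_equiv (Fin.consLinearEquiv R fun _ => A) (.of_extension (i := LinearMap.inl R _ _)
      (p := LinearMap.snd R _ _) LinearMap.inl_injective (fun x => ?_) LinearMap.snd_surjective
      h ih)
    exact ⟨fun hx => ⟨x.1, Prod.ext rfl hx.symm⟩, by rintro ⟨y, rfl⟩; rfl⟩

theorem HasDegreewiseFiniteProjectiveResolution.projPresented (n : ℕ) {M : Type u}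
    [AddCommGroup M] [Module R M] (h : HasDegreewiseFiniteProjectiveResolution R M) :
    ProjPresented R n M := by
  induction n generalizing M with
  | zero =>
    obtain ⟨P, d, ε, hP, hε, -⟩ := h
    have := (hP 0).1
    exact Module.Finite.of_surjective ε hε
  | succ n ih =>
    obtain ⟨P, d, ε, hP, hε, h0, hd⟩ := h
    refine ⟨.of R (LinearMap.ker ε), P 0, (LinearMap.ker ε).subtype, ε, hP 0,
      Subtype.val_injective, exact_subtype_ker ε, hε, ih ?_⟩
    refine ⟨fun i => P (i + 1), fun i => d (i + 1),
      (d 0).codRestrict _ fun x => h0.apply_apply_eq_zero x, fun i => hP (i + 1), ?_, ?_,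
      fun i => hd (i + 1)⟩
    · rintro ⟨x, hx⟩
      obtain ⟨y, rfl⟩ := (h0 x).1 hx
      exact ⟨y, rfl⟩
    · intro x
      rw [← hd 0 x]
      exact Subtype.ext_iff

/-- A free cover of the projective module `P` splits, so its kernel is finitely generated projective
and can be absorbed into the next syzygy by `ker_comp`. -/
theorem ProjPresented.finitelyPresented {n : ℕ} {M : Type u} [AddCommGroup M] [Module R M]
    (h : ProjPresented R n M) : FinitelyPresented R M n := by
  induction n generalizing M with
  | zero =>
    have : Module.Finite R M := h
    obtain ⟨k, ε, hε⟩ := Module.Finite.exists_fin' R M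
    exact ⟨fun _ => k, fun _ => 0, ε, hε, fun h => absurd h (lt_irrefl 0), fun i hi => by omega⟩
  | succ n ih =>
    obtain ⟨K, P, i, p, ⟨_, _⟩, hi, hip, hp, hK⟩ := h
    obtain ⟨k, f, hf⟩ := Module.Finite.exists_fin' R P
    obtain ⟨s, hs⟩ := Module.projective_lifting_property f LinearMap.id hf
    let π : (Fin k → R) →ₗ[R] LinearMap.ker f := (LinearMap.id - s ∘ₗ f).codRestrict _ fun x => by
      have := LinearMap.congr_fun hs (f x)
      simp only [LinearMap.comp_apply, LinearMap.id_apply] at this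
      simp [this]
    have hπ : π ∘ₗ (LinearMap.ker f).subtype = LinearMap.id := by
      ext1 x
      exact Subtype.ext (by simp [π])
    have : Module.Projective R (LinearMap.ker f) := .of_split _ π hπ
    have : Module.Finite R (LinearMap.ker f) := .of_surjective π fun x =>
      ⟨x, LinearMap.congr_fun hπ x⟩
    obtain ⟨k', d, ε, hε, h0, hd⟩ := ih (ProjPresented.ker_comp hi hip hf hK (.of_projective n _))
    refine ⟨fun j => Nat.casesOn j k k', fun j => Nat.casesOn j
      ((LinearMap.ker (p ∘ₗ f)).subtype ∘ₗ ε) d, p ∘ₗ f, hp.comp hf, fun _ x => ?_, fun j hj => ?_⟩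
    · rw [exact_subtype_ker (p ∘ₗ f) x]
      constructor
      · rintro ⟨y, rfl⟩
        obtain ⟨z, rfl⟩ := hε y
        exact ⟨z, rfl⟩
      · rintro ⟨z, rfl⟩
        exact ⟨ε z, rfl⟩
    · cases j with
      | zero =>
        intro x
        rw [← h0 (by omega) x]
        exact (Subtype.ext_iff (a1 := ε x) (a2 := 0)).symm
      | succ j => exact hd j (by omega)

theorem FinitelyPresented.finitePresentation {n : ℕ} (hn : 1 ≤ n) {M : Type u} [AddCommGroup M]
    [Module R M] (h : FinitelyPresented R M n) : Module.FinitePresentation R M := by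
  obtain ⟨k, d, ε, hε, h0, -⟩ := h
  refine Module.finitePresentation_of_surjective ε hε ?_
  rw [(h0 hn).linearMap_ker_eq]
  exact Submodule.FG.of_finite

/-- Generators and relations of a finitely presented module. -/
theorem exists_generators_relations (M : Type u) [AddCommGroup M] [Module R M]
    [Module.FinitePresentation R M] : ∃ (k m : ℕ) (c : Fin k → M) (a : Fin m → Fin k → R),
      (∀ x, ∃ s : Fin k → R, ∑ i, s i • c i = x) ∧ (∀ l, ∑ i, a l i • c i = 0) ∧
        ∀ s : Fin k → R, ∑ i, s i • c i = 0 → ∃ t : Fin m → R, ∀ i, s i = ∑ l, t l * a l i := by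
  obtain ⟨k, K, e, hK⟩ := Module.FinitePresentation.exists_fin R M
  obtain ⟨m, a, ha⟩ := Submodule.fg_iff_exists_fin_generating_family.1 hK
  let f : (Fin k → R) →ₗ[R] M := (e.symm : _ →ₗ[R] M) ∘ₗ K.mkQ
  have hf : ∀ s : Fin k → R, ∑ i, s i • f (Pi.single i 1) = f s := fun s => by
    conv_rhs => rw [pi_eq_sum_univ' s]
    simp [map_sum]
  have hker : ∀ s, f s = 0 ↔ s ∈ K := fun s => by simp [f]
  refine ⟨k, m, fun i => f (Pi.single i 1), a, fun x => ?_, fun l => ?_, fun s hs => ?_⟩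
  · obtain ⟨s, hs⟩ := K.mkQ_surjective (e x)
    exact ⟨s, by rw [hf]; simp [f, hs]⟩
  · rw [hf, hker, ← ha]
    exact Submodule.subset_span ⟨l, rfl⟩
  · rw [hf, hker, ← ha, Submodule.mem_span_range_iff_exists_fun] at hs
    obtain ⟨t, rfl⟩ := hs
    exact ⟨t, fun i => by simp⟩

end Presentations

section GeneratorsRelations

variable {R : Type u} [Ring R] {K F : Type u} [AddCommGroup K] [Module R K] [AddCommGroup F]
  [Module R F]

/-- Maps out of a module given by generators and relations. -/
theorem exists_linearMap_of_relations {k m : ℕ} {c : Fin k → K} {a : Fin m → Fin k → R}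
    (hc : ∀ x, ∃ s : Fin k → R, ∑ i, s i • c i = x)
    (ha : ∀ s : Fin k → R, ∑ i, s i • c i = 0 → ∃ t : Fin m → R, ∀ i, s i = ∑ l, t l * a l i)
    (x : Fin k → F) (hx : ∀ l, ∑ i, a l i • x i = 0) : ∃ h : K →ₗ[R] F, ∀ i, h (c i) = x i := by
  have hsurj : Function.Surjective (Fintype.linearCombination R c) := hc
  have hle : LinearMap.ker (Fintype.linearCombination R c) ≤
      LinearMap.ker (Fintype.linearCombination R x) := by
    intro s hs
    obtain ⟨t, ht⟩ := ha s hs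
    rw [LinearMap.mem_ker, Fintype.linearCombination_apply]
    simp only [ht, Finset.sum_smul, mul_smul]
    rw [Finset.sum_comm]
    simp only [← Finset.smul_sum, hx, smul_zero, Finset.sum_const_zero]
  refine ⟨Submodule.liftQ _ (Fintype.linearCombination R x) hle ∘ₗ
    ((Fintype.linearCombination R c).quotKerEquivOfSurjective hsurj).symm, fun i => ?_⟩
  have h1 : Fintype.linearCombination R c (Pi.single i 1) = c i := by simp
  have h2 : ((Fintype.linearCombination R c).quotKerEquivOfSurjective hsurj).symm (c i) =
      Submodule.mkQ _ (Pi.single i 1) := by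
    rw [LinearEquiv.symm_apply_eq]
    exact h1.symm
  rw [LinearMap.comp_apply, LinearEquiv.coe_coe, h2]
  simp

theorem linearMap_ext_of_generators {k : ℕ} {c : Fin k → K}
    (hc : ∀ x, ∃ s : Fin k → R, ∑ i, s i • c i = x) {g h : K →ₗ[R] F}
    (hgh : ∀ i, g (c i) = h (c i)) : g = h := by
  ext x
  obtain ⟨s, rfl⟩ := hc x
  simp [hgh]

/-- Maps from finitely presented modules lift along pure quotients. -/
theorem IsPure.exists_lift [Module.FinitePresentation R K] {P : Submodule R F} (hP : IsPure P)
    (g : K →ₗ[R] F ⧸ P) : ∃ h : K →ₗ[R] F, P.mkQ ∘ₗ h = g := by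
  obtain ⟨k, m, c, a, hc, hac, ha⟩ := exists_generators_relations (R := R) K
  -- Lifts of the images of the generators satisfy the relations only modulo `P`. Purity realizes
  -- the errors by a tuple `y` in `P`, and `x - y` satisfies the relations exactly.
  choose x hx using fun i => P.mkQ_surjective (g (c i))
  obtain ⟨y, hy, hyx⟩ := hP m k a x (fun _ => trivial) fun l => by
    rw [← Submodule.ker_mkQ P, LinearMap.mem_ker, map_sum]
    simp only [map_smul, hx]
    simpa using congrArg g (hac l)
  obtain ⟨h, hh⟩ := exists_linearMap_of_relations hc ha (x - y) fun l => by
    simp only [Pi.sub_apply, smul_sub, Finset.sum_sub_distrib]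
    rw [hyx, sub_self]
  refine ⟨h, linearMap_ext_of_generators hc fun i => ?_⟩
  have : P.mkQ (y i) = 0 := by
    rw [← LinearMap.mem_ker, Submodule.ker_mkQ]
    exact hy i
  rw [LinearMap.comp_apply, hh, Pi.sub_apply, map_sub, this, sub_zero, hx]

end GeneratorsRelations

/-! ### The balanced tensor product, purity and products -/

section Tensor

variable {R : Type u} [Ring R] {K L N : Type u} [AddCommGroup K] [Module Rᵐᵒᵖ K]
  [AddCommGroup L] [Module Rᵐᵒᵖ L] [AddCommGroup N] [Module Rᵐᵒᵖ N]
  {Y Z V : Type u} [AddCommGroup Y] [Module R Y] [AddCommGroup Z] [Module R Z]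
  [AddCommGroup V] [Module R V]

variable (R) in
/-- The element `k ⊗ y` of `K ⊗_R Y`. -/
def tmul (k : K) (y : Y) : BalancedTensor R K Y := QuotientAddGroup.mk (k ⊗ₜ[ℤ] y)

theorem tmul_add (k : K) (y y' : Y) : tmul R k (y + y') = tmul R k y + tmul R k y' :=
  congrArg QuotientAddGroup.mk (TensorProduct.tmul_add k y y')

theorem add_tmul (k₁ k₂ : K) (y : Y) : tmul R (k₁ + k₂) y = tmul R k₁ y + tmul R k₂ y :=
  congrArg QuotientAddGroup.mk (TensorProduct.add_tmul k₁ k₂ y)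

/-- The biadditive map `K × Y → K ⊗_R Y`. -/
def tmulHom (R : Type u) [Ring R] (K Y : Type u) [AddCommGroup K] [Module Rᵐᵒᵖ K]
    [AddCommGroup Y] [Module R Y] : K →+ Y →+ BalancedTensor R K Y :=
  AddMonoidHom.mk' (fun k => AddMonoidHom.mk' (tmul R k) (tmul_add k)) fun k k' =>
    AddMonoidHom.ext (add_tmul k k')

theorem tmul_zero (k : K) : tmul R k (0 : Y) = 0 := map_zero (tmulHom R K Y k)

theorem zero_tmul (y : Y) : tmul R (0 : K) y = 0 :=
  DFunLike.congr_fun (map_zero (tmulHom R K Y)) y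

theorem tmul_sub (k : K) (y y' : Y) : tmul R k (y - y') = tmul R k y - tmul R k y' :=
  map_sub (tmulHom R K Y k) y y'

theorem tmul_sum {ι : Type*} (s : Finset ι) (k : K) (y : ι → Y) :
    tmul R k (∑ i ∈ s, y i) = ∑ i ∈ s, tmul R k (y i) := map_sum (tmulHom R K Y k) y s

theorem sum_tmul {ι : Type*} (s : Finset ι) (k : ι → K) (y : Y) :
    tmul R (∑ i ∈ s, k i) y = ∑ i ∈ s, tmul R (k i) y :=
  map_sum ((AddMonoidHom.eval y).comp (tmulHom R K Y)) k s

theorem smul_tmul (r : Rᵐᵒᵖ) (k : K) (y : Y) : tmul R (r • k) y = tmul R k (unop r • y) := by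
  refine QuotientAddGroup.eq.2 ?_
  have h : (op (unop r) • k) ⊗ₜ[ℤ] y - k ⊗ₜ[ℤ] (unop r • y) ∈ balancingSubgroup R K Y :=
    AddSubgroup.subset_closure ⟨k, unop r, y, rfl⟩
  have := (balancingSubgroup R K Y).neg_mem h
  rw [neg_sub, sub_eq_neg_add] at this
  exact this

theorem tensor_induction {p : BalancedTensor R K Y → Prop} (t : BalancedTensor R K Y)
    (h0 : p 0) (ht : ∀ k y, p (tmul R k y)) (hadd : ∀ s t, p s → p t → p (s + t)) : p t := by
  obtain ⟨x, rfl⟩ := QuotientAddGroup.mk_surjective t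
  induction x with
  | zero => exact h0
  | tmul k y => exact ht k y
  | add x y hx hy => exact hadd _ _ hx hy

theorem tensor_hom_ext {A : Type*} [AddCommGroup A] {φ ψ : BalancedTensor R K Y →+ A}
    (h : ∀ k y, φ (tmul R k y) = ψ (tmul R k y)) : φ = ψ := balancedTensor_hom_ext R K Y h

/-- The universal property of the balanced tensor product. -/
def tensorLift {A : Type u} [AddCommGroup A] (φ : K →+ Y →+ A)
    (hφ : ∀ (r : R) k y, φ (op r • k) y = φ k (r • y)) : BalancedTensor R K Y →+ A :=
  QuotientAddGroup.lift (balancingSubgroup R K Y)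
    (TensorProduct.liftAddHom (R := ℤ) φ fun n k y => by simp) <| by
      refine (AddSubgroup.closure_le _).2 ?_
      rintro _ ⟨k, r, y, rfl⟩
      simp [hφ]

theorem tensorLift_tmul {A : Type u} [AddCommGroup A] (φ : K →+ Y →+ A)
    (hφ : ∀ (r : R) k y, φ (op r • k) y = φ k (r • y)) (k : K) (y : Y) :
    tensorLift φ hφ (tmul R k y) = φ k y := rfl

theorem balancedMap_tmul (f : K →ₗ[Rᵐᵒᵖ] L) (k : K) (y : Y) :
    balancedMap Y f (tmul R k y) = tmul R (f k) y := rfl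

theorem balancedMap_comp_apply (g : L →ₗ[Rᵐᵒᵖ] N) (f : K →ₗ[Rᵐᵒᵖ] L)
    (t : BalancedTensor R K Y) : balancedMap Y (g ∘ₗ f) t = balancedMap Y g (balancedMap Y f t) :=
  DFunLike.congr_fun (tensor_hom_ext (φ := balancedMap Y (g ∘ₗ f))
    (ψ := (balancedMap Y g).comp (balancedMap Y f)) fun _ _ => rfl) t

variable (K) in
/-- The map `K ⊗ g : K ⊗_R Y → K ⊗_R Z`. -/
def tensorMap (g : Y →ₗ[R] Z) : BalancedTensor R K Y →+ BalancedTensor R K Z :=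
  QuotientAddGroup.map (balancingSubgroup R K Y) (balancingSubgroup R K Z)
    (LinearMap.lTensor K g.toAddMonoidHom.toIntLinearMap).toAddMonoidHom <| by
      refine (AddSubgroup.closure_le _).2 ?_
      rintro _ ⟨k, r, y, rfl⟩
      refine AddSubgroup.subset_closure ⟨k, r, g y, ?_⟩
      simp

theorem tensorMap_tmul (g : Y →ₗ[R] Z) (k : K) (y : Y) :
    tensorMap K g (tmul R k y) = tmul R k (g y) := rfl

theorem tensorMap_comp_apply (h : Z →ₗ[R] V) (g : Y →ₗ[R] Z) (t : BalancedTensor R K Y) :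
    tensorMap K (h ∘ₗ g) t = tensorMap K h (tensorMap K g t) :=
  DFunLike.congr_fun (tensor_hom_ext (φ := tensorMap K (h ∘ₗ g))
    (ψ := (tensorMap K h).comp (tensorMap K g)) fun _ _ => rfl) t

theorem balancedMap_tensorMap (f : K →ₗ[Rᵐᵒᵖ] L) (g : Y →ₗ[R] Z) (t : BalancedTensor R K Y) :
    balancedMap Z f (tensorMap K g t) = tensorMap L g (balancedMap Y f t) :=
  DFunLike.congr_fun (tensor_hom_ext (φ := (balancedMap Z f).comp (tensorMap K g))
    (ψ := (tensorMap L g).comp (balancedMap Y f)) fun _ _ => rfl) t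

theorem tensorMap_surjective {g : Y →ₗ[R] Z} (hg : Function.Surjective g) :
    Function.Surjective (tensorMap K g) := by
  intro t
  induction t using tensor_induction with
  | h0 => exact ⟨0, map_zero _⟩
  | ht k z =>
    obtain ⟨y, rfl⟩ := hg z
    exact ⟨tmul R k y, rfl⟩
  | hadd s t hs ht =>
    obtain ⟨a, rfl⟩ := hs
    obtain ⟨b, rfl⟩ := ht
    exact ⟨a + b, map_add _ _ _⟩

/-- Right exactness over `ℤ` descends to the quotients because surjectivity of `ε` makes the
balancing subgroup for `N` an image of the one for `L`. -/
theorem balancedMap_exact {d : K →ₗ[Rᵐᵒᵖ] L} {ε : L →ₗ[Rᵐᵒᵖ] N} (h : Function.Exact d ε)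
    (hε : Function.Surjective ε) : Function.Exact (balancedMap Y d) (balancedMap Y ε) := by
  let d' := d.toAddMonoidHom.toIntLinearMap
  let ε' := ε.toAddMonoidHom.toIntLinearMap
  have hex : Function.Exact (LinearMap.rTensor Y d') (LinearMap.rTensor Y ε') :=
    rTensor_exact (f := d') (g := ε') Y h hε
  intro t
  constructor
  · intro ht
    obtain ⟨x, rfl⟩ := QuotientAddGroup.mk_surjective t
    have hx : LinearMap.rTensor Y ε' x ∈ balancingSubgroup R N Y :=
      (QuotientAddGroup.eq_zero_iff _).1 ht
    have hle : balancingSubgroup R N Y ≤ (balancingSubgroup R L Y).map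
        (LinearMap.rTensor Y ε').toAddMonoidHom := by
      refine (AddSubgroup.closure_le _).2 ?_
      rintro _ ⟨k, r, y, rfl⟩
      obtain ⟨l, rfl⟩ := hε k
      refine ⟨_, AddSubgroup.subset_closure ⟨l, r, y, rfl⟩, ?_⟩
      simp [ε']
    obtain ⟨b, hb, hbx⟩ := hle hx
    obtain ⟨w, hw⟩ := (hex (x - b)).1 (by
      rw [map_sub, sub_eq_zero]
      exact hbx.symm)
    refine ⟨QuotientAddGroup.mk w, ?_⟩
    have h1 : balancedMap Y d (QuotientAddGroup.mk w) = QuotientAddGroup.mk (x - b) :=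
      congrArg QuotientAddGroup.mk hw
    rw [h1]
    refine QuotientAddGroup.eq.2 ?_
    simpa using hb
  · rintro ⟨s, rfl⟩
    rw [← balancedMap_comp_apply]
    have h0 : ε ∘ₗ d = 0 := LinearMap.ext h.apply_apply_eq_zero
    rw [h0]
    exact DFunLike.congr_fun (tensor_hom_ext (φ := balancedMap Y (0 : K →ₗ[Rᵐᵒᵖ] N)) (ψ := 0)
      fun _ y => zero_tmul y) s

theorem tensorMap_exact {d : Y →ₗ[R] Z} {ε : Z →ₗ[R] V} (h : Function.Exact d ε)
    (hε : Function.Surjective ε) : Function.Exact (tensorMap K d) (tensorMap K ε) := by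
  let d' := d.toAddMonoidHom.toIntLinearMap
  let ε' := ε.toAddMonoidHom.toIntLinearMap
  have hex : Function.Exact (LinearMap.lTensor K d') (LinearMap.lTensor K ε') :=
    lTensor_exact (f := d') (g := ε') K h hε
  intro t
  constructor
  · intro ht
    obtain ⟨x, rfl⟩ := QuotientAddGroup.mk_surjective t
    have hx : LinearMap.lTensor K ε' x ∈ balancingSubgroup R K V :=
      (QuotientAddGroup.eq_zero_iff _).1 ht
    have hle : balancingSubgroup R K V ≤ (balancingSubgroup R K Z).map
        (LinearMap.lTensor K ε').toAddMonoidHom := by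
      refine (AddSubgroup.closure_le _).2 ?_
      rintro _ ⟨k, r, y, rfl⟩
      obtain ⟨l, rfl⟩ := hε y
      refine ⟨_, AddSubgroup.subset_closure ⟨k, r, l, rfl⟩, ?_⟩
      simp [ε']
    obtain ⟨b, hb, hbx⟩ := hle hx
    obtain ⟨w, hw⟩ := (hex (x - b)).1 (by
      rw [map_sub, sub_eq_zero]
      exact hbx.symm)
    refine ⟨QuotientAddGroup.mk w, ?_⟩
    have h1 : tensorMap K d (QuotientAddGroup.mk w) = QuotientAddGroup.mk (x - b) :=
      congrArg QuotientAddGroup.mk hw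
    rw [h1]
    refine QuotientAddGroup.eq.2 ?_
    simpa using hb
  · rintro ⟨s, rfl⟩
    rw [← tensorMap_comp_apply]
    have h0 : ε ∘ₗ d = 0 := LinearMap.ext h.apply_apply_eq_zero
    rw [h0]
    exact DFunLike.congr_fun (tensor_hom_ext (φ := tensorMap K (0 : Y →ₗ[R] V)) (ψ := 0)
      fun k _ => tmul_zero k) s

theorem exists_eq_sum_tmul {k : ℕ} {c : Fin k → K}
    (hc : ∀ x, ∃ s : Fin k → Rᵐᵒᵖ, ∑ i, s i • c i = x) (t : BalancedTensor R K Y) :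
    ∃ y : Fin k → Y, ∑ i, tmul R (c i) (y i) = t := by
  induction t using tensor_induction with
  | h0 => exact ⟨0, by simp [tmul_zero]⟩
  | ht x y =>
    obtain ⟨s, rfl⟩ := hc x
    exact ⟨fun i => unop (s i) • y, by simp only [sum_tmul, smul_tmul]⟩
  | hadd s t hs ht =>
    obtain ⟨a, rfl⟩ := hs
    obtain ⟨b, rfl⟩ := ht
    exact ⟨a + b, by simp [tmul_add, Finset.sum_add_distrib]⟩

/-- Relations of `K` yield relations in `K ⊗_R Y`. -/
theorem sum_tmul_eq_zero_of_relations {k m : ℕ} {c : Fin k → K} {a : Fin m → Fin k → Rᵐᵒᵖ}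
    (hac : ∀ l, ∑ i, a l i • c i = 0) {y : Fin k → Y} (z : Fin m → Y)
    (hz : ∀ i, y i = ∑ l, unop (a l i) • z l) : ∑ i, tmul R (c i) (y i) = 0 := by
  simp only [hz, tmul_sum, ← smul_tmul]
  rw [Finset.sum_comm]
  simp only [← sum_tmul, hac, zero_tmul, Finset.sum_const_zero]

/-- All relations in `K ⊗_R Y` between the generators of `K` come from relations in `K`. -/
theorem exists_of_sum_tmul_eq_zero {k m : ℕ} {c : Fin k → K} {a : Fin m → Fin k → Rᵐᵒᵖ}
    (hc : ∀ x, ∃ s : Fin k → Rᵐᵒᵖ, ∑ i, s i • c i = x)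
    (ha : ∀ s : Fin k → Rᵐᵒᵖ, ∑ i, s i • c i = 0 → ∃ t : Fin m → Rᵐᵒᵖ, ∀ i, s i = ∑ l, t l * a l i)
    {y : Fin k → Y} (hy : ∑ i, tmul R (c i) (y i) = 0) :
    ∃ z : Fin m → Y, ∀ i, y i = ∑ l, unop (a l i) • z l := by
  let ρ : (Fin m → Y) →+ (Fin k → Y) := AddMonoidHom.mk' (fun z i => ∑ l, unop (a l i) • z l)
    fun z z' => by
      funext i
      simp [smul_add, Finset.sum_add_distrib]
  -- The candidate for `K ⊗_R Y`: the biadditive map `(∑ s i • c i, y) ↦ [s i • y]` to `Q` is well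
  -- defined because two expressions of an element of `K` differ by relations. Its lift sends the
  -- given tensor to the class of `y`.
  let Q := (Fin k → Y) ⧸ ρ.range
  let φ : (Fin k → Rᵐᵒᵖ) → Y → Q := fun s y => QuotientAddGroup.mk fun i => unop (s i) • y
  have hφ : ∀ s s' : Fin k → Rᵐᵒᵖ, ∑ i, s i • c i = ∑ i, s' i • c i → ∀ y, φ s y = φ s' y := by
    intro s s' h y
    obtain ⟨t, ht⟩ := ha (s' - s) (by simp [sub_smul, Finset.sum_sub_distrib, h])
    refine QuotientAddGroup.eq.2 ⟨fun l => unop (t l) • y, ?_⟩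
    funext i
    have hi := congrArg (fun r : Rᵐᵒᵖ => unop r • y) (ht i)
    simp only [Pi.sub_apply, MulOpposite.unop_sub, sub_smul, Finset.unop_sum, Finset.sum_smul,
      MulOpposite.unop_mul, mul_smul] at hi
    simp only [ρ, AddMonoidHom.mk'_apply, ← hi, Pi.add_apply, Pi.neg_apply]
    abel
  choose s hs using hc
  let ψ : K →+ Y →+ Q := AddMonoidHom.mk' (fun x => AddMonoidHom.mk' (φ (s x)) fun y y' => by
      simp only [φ, smul_add]
      rfl) fun x x' => by
    ext y
    refine (hφ _ (s x + s x') ?_ y).trans ?_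
    · simp [hs, add_smul, Finset.sum_add_distrib]
    · simp only [φ, Pi.add_apply, MulOpposite.unop_add, add_smul]
      rfl
  have hψ : ∀ (r : R) x y, ψ (op r • x) y = ψ x (r • y) := by
    intro r x y
    refine (hφ _ (fun i => op r * s x i) ?_ y).trans ?_
    · simp only [hs, mul_smul, ← Finset.smul_sum]
    · simp only [φ, MulOpposite.unop_mul, unop_op, mul_smul]
      rfl
  have hψc : ∀ i y, ψ (c i) y = QuotientAddGroup.mk (Pi.single i y) := by
    intro i y
    refine (hφ _ (Pi.single i 1) ?_ y).trans ?_
    · simp [hs, Pi.single_apply]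
    · refine congrArg QuotientAddGroup.mk ?_
      funext j
      rcases eq_or_ne j i with rfl | hj
      · simp
      · simp [hj]
  have h0 := congrArg (tensorLift ψ hψ) hy
  simp only [map_sum, tensorLift_tmul, hψc, map_zero] at h0
  have h1 : (QuotientAddGroup.mk y : Q) = 0 := by
    have h2 := map_sum (QuotientAddGroup.mk' ρ.range) (fun i => Pi.single i (y i)) Finset.univ
    rw [Finset.univ_sum_single] at h2
    exact h2.trans h0
  obtain ⟨z, hz⟩ := (QuotientAddGroup.eq_zero_iff _).1 h1
  exact ⟨z, fun i => (congrFun hz i).symm⟩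

/-- Tensoring with a finitely presented module preserves pure submodules. -/
theorem IsPure.tensorMap_injective [Module.FinitePresentation Rᵐᵒᵖ K] {P : Submodule R Y}
    (hP : IsPure P) : Function.Injective (tensorMap K P.subtype) := by
  obtain ⟨k, m, c, a, hc, hac, ha⟩ := exists_generators_relations (R := Rᵐᵒᵖ) K
  refine (injective_iff_map_eq_zero _).2 fun t ht => ?_
  obtain ⟨p, rfl⟩ := exists_eq_sum_tmul hc t
  simp only [map_sum, tensorMap_tmul] at ht
  -- Vanishing in `K ⊗_R Y` means solvability in `Y` of a finite system with constants in `P`;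
  -- purity solves it in `P`.
  obtain ⟨z, hz⟩ := exists_of_sum_tmul_eq_zero hc ha ht
  obtain ⟨q, hq, hqz⟩ := hP k m (fun i l => unop (a l i)) z (fun _ => trivial) fun i => by
    rw [← hz]
    exact (p i).2
  refine sum_tmul_eq_zero_of_relations hac (fun l => ⟨q l, hq l⟩) fun i => Subtype.ext ?_
  simpa [hqz] using hz i

theorem tensor_pi_injective [Module.FinitePresentation Rᵐᵒᵖ K] {ι : Type u} {Y : ι → Type u}
    [∀ j, AddCommGroup (Y j)] [∀ j, Module R (Y j)] {t : BalancedTensor R K (∀ j, Y j)}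
    (ht : ∀ j, tensorMap K (LinearMap.proj j : (∀ j, Y j) →ₗ[R] Y j) t = 0) : t = 0 := by
  obtain ⟨k, m, c, a, hc, hac, ha⟩ := exists_generators_relations (R := Rᵐᵒᵖ) K
  obtain ⟨y, rfl⟩ := exists_eq_sum_tmul hc t
  simp only [map_sum, tensorMap_tmul] at ht
  choose z hz using fun j => exists_of_sum_tmul_eq_zero hc ha (ht j)
  refine sum_tmul_eq_zero_of_relations hac (fun l j => z j l) fun i => funext fun j => ?_
  simpa using hz j i

theorem tensor_pi_surjective [Module.FinitePresentation Rᵐᵒᵖ K] {ι : Type u} {Y : ι → Type u}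
    [∀ j, AddCommGroup (Y j)] [∀ j, Module R (Y j)] (s : ∀ j, BalancedTensor R K (Y j)) :
    ∃ t : BalancedTensor R K (∀ j, Y j),
      ∀ j, tensorMap K (LinearMap.proj j : (∀ j, Y j) →ₗ[R] Y j) t = s j := by
  obtain ⟨k, m, c, a, hc, -, -⟩ := exists_generators_relations (R := Rᵐᵒᵖ) K
  choose y hy using fun j => exists_eq_sum_tmul hc (s j)
  exact ⟨∑ i, tmul R (c i) fun j => y j i, fun j => by simpa [tensorMap_tmul] using hy j⟩

theorem eq_zero_of_one_tmul_eq_zero {y : Y} (h : tmul R (1 : Rᵐᵒᵖ) y = 0) : y = 0 := by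
  let φ : Rᵐᵒᵖ →+ Y →+ Y := AddMonoidHom.mk' (fun r => AddMonoidHom.mk' (fun y => unop r • y)
    (smul_add _)) fun r r' => AddMonoidHom.ext fun y => by simp [add_smul]
  have h1 := congrArg (tensorLift φ fun r r' y => by simp [φ, mul_smul]) h
  rw [tensorLift_tmul, map_zero] at h1
  simpa [φ] using h1

theorem exists_one_tmul (t : BalancedTensor R Rᵐᵒᵖ Y) : ∃ y, tmul R (1 : Rᵐᵒᵖ) y = t := by
  obtain ⟨y, hy⟩ := exists_eq_sum_tmul (c := fun _ : Fin 1 => (1 : Rᵐᵒᵖ))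
    (fun x => ⟨fun _ => x, by simp⟩) t
  exact ⟨y 0, by simpa using hy⟩

/-- With `exists_tensor_fin` this identifies `K ^ k ⊗_R Y` with `(K ⊗_R Y) ^ k`, which turns a tuple
of tensors into a single one. -/
theorem tensor_fin_ext {k : ℕ} {t t' : BalancedTensor R (Fin k → K) Y}
    (h : ∀ i, balancedMap Y (LinearMap.proj i : (Fin k → K) →ₗ[Rᵐᵒᵖ] K) t =
      balancedMap Y (LinearMap.proj i) t') : t = t' := by
  have key : ∀ t : BalancedTensor R (Fin k → K) Y, t = ∑ i, balancedMap Y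
      (LinearMap.single Rᵐᵒᵖ (fun _ => K) i) (balancedMap Y (LinearMap.proj i) t) := by
    intro t
    induction t using tensor_induction with
    | h0 => simp
    | ht x y =>
      simp only [balancedMap_tmul, ← sum_tmul]
      congr 1
      simp [Finset.univ_sum_single]
    | hadd s t hs ht =>
      simp only [map_add, Finset.sum_add_distrib]
      rw [← hs, ← ht]
  rw [key t, key t']
  simp only [h]

theorem exists_tensor_fin {k : ℕ} (τ : Fin k → BalancedTensor R K Y) :
    ∃ t : BalancedTensor R (Fin k → K) Y,
      ∀ i, balancedMap Y (LinearMap.proj i : (Fin k → K) →ₗ[Rᵐᵒᵖ] K) t = τ i := by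
  refine ⟨∑ i, balancedMap Y (LinearMap.single Rᵐᵒᵖ (fun _ => K) i) (τ i), fun i => ?_⟩
  rw [map_sum, Finset.sum_eq_single i]
  · rw [← balancedMap_comp_apply, LinearMap.proj_comp_single_same]
    exact DFunLike.congr_fun (tensor_hom_ext (φ := balancedMap Y (LinearMap.id : K →ₗ[Rᵐᵒᵖ] K))
      (ψ := AddMonoidHom.id _) fun _ _ => rfl) (τ i)
  · intro j _ hj
    rw [← balancedMap_comp_apply, LinearMap.proj_comp_single_ne _ _ _ _ hj.symm]
    exact DFunLike.congr_fun (tensor_hom_ext (φ := balancedMap Y (0 : K →ₗ[Rᵐᵒᵖ] K)) (ψ := 0)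
      fun _ y => zero_tmul y) (τ j)
  · simp

end Tensor

/-! ### Closure properties of `fp_n`-injective and `fp_n`-flat modules -/

section FpInjective

variable {n : ℕ} {S : Type u} [Ring S] {X X' : Type u} [AddCommGroup X] [Module S X]
  [AddCommGroup X'] [Module S X']

theorem IsFpInjective.of_equiv (e : X ≃ₗ[S] X') (h : IsFpInjective n S X) :
    IsFpInjective n S X' := by
  intro K L f hK hL hf g
  obtain ⟨k, hk⟩ := h K L f hK hL hf ((e.symm : X' →ₗ[S] X) ∘ₗ g)
  refine ⟨(e : X →ₗ[S] X') ∘ₗ k, LinearMap.ext fun x => ?_⟩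
  simpa using congrArg e (LinearMap.congr_fun hk x)

theorem IsFpInjective.pi {ι : Type u} {X : ι → Type u} [∀ j, AddCommGroup (X j)]
    [∀ j, Module S (X j)] (h : ∀ j, IsFpInjective n S (X j)) : IsFpInjective n S (∀ j, X j) := by
  intro K L f hK hL hf g
  choose k hk using fun j => h j K L f hK hL hf (LinearMap.proj j ∘ₗ g)
  refine ⟨LinearMap.pi k, LinearMap.ext fun x => funext fun j => ?_⟩
  simpa using LinearMap.congr_fun (hk j) x

/-- Extend `g` to `k : L → X`. Modulo `P`, it factors through the finitely presented cokernel of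
`f`, and lifts from there to `l`; the difference of `k` and `l` has values in `P` and still extends
`g`. -/
theorem IsFpInjective.pure_sub (hn : 1 ≤ n) (h : IsFpInjective n S X) {P : Submodule S X}
    (hP : IsPure P) : IsFpInjective n S P := by
  intro K L f hK hL hf g
  obtain ⟨k, hk⟩ := h K L f hK hL hf (P.subtype ∘ₗ g)
  have hk' : ∀ x, k (f x) = g x := fun x => LinearMap.congr_fun hk x
  have := hK.finitePresentation hn
  have := hL.finitePresentation hn
  have hfg : (LinearMap.range f).FG := Submodule.FG.of_finite
  have : Module.FinitePresentation S (L ⧸ LinearMap.range f) :=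
    Module.finitePresentation_of_surjective (LinearMap.range f).mkQ
      (Submodule.mkQ_surjective _) (by rwa [Submodule.ker_mkQ])
  obtain ⟨l, hl⟩ := hP.exists_lift ((LinearMap.range f).liftQ (P.mkQ ∘ₗ k) (by
    rintro _ ⟨x, rfl⟩
    simp [hk']))
  have hl' : ∀ y, P.mkQ (l (Submodule.mkQ _ y)) = P.mkQ (k y) := fun y =>
    LinearMap.congr_fun hl (Submodule.mkQ _ y)
  refine ⟨(k - l ∘ₗ Submodule.mkQ _).codRestrict P fun y => ?_, LinearMap.ext fun x =>
    Subtype.ext ?_⟩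
  · rw [← Submodule.ker_mkQ P, LinearMap.mem_ker, LinearMap.sub_apply, map_sub,
      LinearMap.comp_apply, hl', sub_self]
  · have h0 : (LinearMap.range f).mkQ (f x) = 0 := by simp
    change k (f x) - l ((LinearMap.range f).mkQ (f x)) = g x
    rw [h0, map_zero, sub_zero, hk']

theorem IsFpInjective.pure_quotient (hn : 1 ≤ n) (h : IsFpInjective n S X) {P : Submodule S X}
    (hP : IsPure P) : IsFpInjective n S (X ⧸ P) := by
  intro K L f hK hL hf g
  have := hK.finitePresentation hn
  obtain ⟨k, hk⟩ := hP.exists_lift g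
  obtain ⟨l, hl⟩ := h K L f hK hL hf k
  exact ⟨P.mkQ ∘ₗ l, by rw [← hk, ← hl]; rfl⟩

end FpInjective

section FpFlat

variable {n : ℕ} {R : Type u} [Ring R] {Y Y' : Type u} [AddCommGroup Y] [Module R Y]
  [AddCommGroup Y'] [Module R Y']

theorem exact_subtype_mkQ (P : Submodule R Y) : Function.Exact P.subtype P.mkQ := fun y => by
  rw [← LinearMap.mem_ker, Submodule.ker_mkQ]
  exact ⟨fun h => ⟨⟨y, h⟩, rfl⟩, by rintro ⟨p, rfl⟩; exact p.2⟩

theorem exact_mkQ_range (f : Y →ₗ[R] Y') : Function.Exact f (LinearMap.range f).mkQ := fun y => by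
  rw [← LinearMap.mem_ker, Submodule.ker_mkQ]
  rfl

theorem IsFpFlat.pi (hn : 1 ≤ n) {ι : Type u} {Y : ι → Type u} [∀ j, AddCommGroup (Y j)]
    [∀ j, Module R (Y j)] (h : ∀ j, IsFpFlat n R (Y j)) : IsFpFlat n R (∀ j, Y j) := by
  intro K L f hK hL hf
  have := hK.finitePresentation hn
  refine (injective_iff_map_eq_zero _).2 fun t ht => tensor_pi_injective fun j => ?_
  refine h j K L f hK hL hf ?_
  rw [balancedMap_tensorMap, ht, map_zero, map_zero]

theorem IsFpFlat.pure_sub (hn : 1 ≤ n) (h : IsFpFlat n R Y) {P : Submodule R Y}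
    (hP : IsPure P) : IsFpFlat n R P := by
  intro K L f hK hL hf
  have := hK.finitePresentation hn
  refine (injective_iff_map_eq_zero _).2 fun t ht => ?_
  refine hP.tensorMap_injective ?_
  refine h K L f hK hL hf ?_
  rw [balancedMap_tensorMap, ht]
  simp

/-- A diagram chase in the rows `- ⊗ P`, `- ⊗ Y`, `- ⊗ (Y ⧸ P)`. The cokernel of `f` is finitely
presented, so its tensor product with `P` embeds into the one with `Y`; this pulls an element of `L
⊗ P` back to `K ⊗ P`. -/
theorem IsFpFlat.pure_quotient (hn : 1 ≤ n) (h : IsFpFlat n R Y) {P : Submodule R Y}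
    (hP : IsPure P) : IsFpFlat n R (Y ⧸ P) := by
  intro K L f hK hL hf
  have := hK.finitePresentation hn
  have := hL.finitePresentation hn
  have hfg : (LinearMap.range f).FG := Submodule.FG.of_finite
  have : Module.FinitePresentation Rᵐᵒᵖ (L ⧸ LinearMap.range f) :=
    Module.finitePresentation_of_surjective (LinearMap.range f).mkQ
      (Submodule.mkQ_surjective _) (by rwa [Submodule.ker_mkQ])
  have hexK := tensorMap_exact (K := K) (exact_subtype_mkQ P) P.mkQ_surjective
  have hexL := tensorMap_exact (K := L) (exact_subtype_mkQ P) P.mkQ_surjective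
  have hexP := balancedMap_exact (Y := P) (exact_mkQ_range f) (Submodule.mkQ_surjective _)
  have hexY := balancedMap_exact (Y := Y) (exact_mkQ_range f) (Submodule.mkQ_surjective _)
  refine (injective_iff_map_eq_zero _).2 fun t ht => ?_
  obtain ⟨t, rfl⟩ := tensorMap_surjective P.mkQ_surjective t
  rw [balancedMap_tensorMap] at ht
  obtain ⟨s, hs⟩ := (hexL _).1 ht
  have h0 : balancedMap P (LinearMap.range f).mkQ s = 0 := by
    refine hP.tensorMap_injective ?_
    rw [← balancedMap_tensorMap, hs, hexY.apply_apply_eq_zero, map_zero]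
  obtain ⟨s, rfl⟩ := (hexP _).1 h0
  rw [← balancedMap_tensorMap] at hs
  rw [← h K L f hK hL hf hs, hexK.apply_apply_eq_zero]

end FpFlat

/-! ### Dualizing a presentation of `C` into `C` -/

section Copresentation

variable {A B : Type u} [Ring A] [Ring B] {C : Type u} [AddCommGroup C] [Module A C] [Module B C]
  [SMulCommClass B A C]

/-- If multiplication identifies `B` with the endomorphisms of the `A`-module `C`, then a
presentation of the `A`-module `C` dualizes to an exact sequence `0 → B → C ^ k → C ^ m` of
`B`-modules. -/
theorem exists_copresentation {n : ℕ} (hn : 1 ≤ n) (hinj : ∀ b : B, (∀ c : C, b • c = 0) → b = 0)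
    (hsurj : ∀ h : C →ₗ[A] C, ∃ b : B, ∀ c, h c = b • c) (hC : ∀ n, ProjPresented B n C)
    {k m : ℕ} {c : Fin k → C} {a : Fin m → Fin k → A}
    (hc : ∀ x, ∃ s : Fin k → A, ∑ i, s i • c i = x) (hac : ∀ l, ∑ i, a l i • c i = 0)
    (ha : ∀ s : Fin k → A, ∑ i, s i • c i = 0 → ∃ t : Fin m → A, ∀ i, s i = ∑ l, t l * a l i) :
    ∃ (j : B →ₗ[B] (Fin k → C)) (w : ((Fin k → C) ⧸ LinearMap.range j) →ₗ[B] (Fin m → C)),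
      (∀ b i, j b i = b • c i) ∧ Function.Injective j ∧ Function.Injective w ∧
        (∀ x l, w (Submodule.mkQ _ x) l = ∑ i, a l i • x i) ∧
        FinitelyPresented B ((Fin k → C) ⧸ LinearMap.range j) n := by
  have : SMulCommClass A B C := SMulCommClass.symm _ _ _
  let j : B →ₗ[B] (Fin k → C) := LinearMap.pi fun i => LinearMap.toSpanSingleton B C (c i)
  have hj : ∀ b i, j b i = b • c i := fun b i => rfl
  let w₀ : (Fin k → C) →ₗ[B] (Fin m → C) :=
    { toFun := fun x l => ∑ i, a l i • x i
      map_add' := fun x y => funext fun l => by simp [smul_add, Finset.sum_add_distrib]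
      map_smul' := fun b x => funext fun l => by
        simp [Finset.smul_sum, smul_comm b] }
  have hw₀ : ∀ x l, w₀ x l = ∑ i, a l i • x i := fun _ _ => rfl
  have hjw : LinearMap.range j ≤ LinearMap.ker w₀ := by
    rintro _ ⟨b, rfl⟩
    refine funext fun l => ?_
    simp only [hw₀, hj, smul_comm _ b, ← Finset.smul_sum, hac, smul_zero, Pi.zero_apply]
  -- A tuple satisfying the relations is the image of the generators under an `A`-endomorphism of
  -- `C`, which is multiplication by some `b`.
  have hwj : LinearMap.ker w₀ ≤ LinearMap.range j := by
    intro x hx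
    obtain ⟨h, hh⟩ := exists_linearMap_of_relations hc ha x fun l => congrFun hx l
    obtain ⟨b, hb⟩ := hsurj h
    exact ⟨b, funext fun i => by rw [hj, ← hb, hh]⟩
  have hji : Function.Injective j := by
    refine (injective_iff_map_eq_zero _).2 fun b hb => hinj b fun x => ?_
    obtain ⟨s, rfl⟩ := hc x
    have : ∀ i, b • c i = 0 := fun i => congrFun hb i
    simp only [Finset.smul_sum, smul_comm b, this, smul_zero, Finset.sum_const_zero]
  refine ⟨j, (LinearMap.range j).liftQ w₀ hjw, hj, hji, ?_, fun _ _ => rfl, ?_⟩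
  · rw [← LinearMap.ker_eq_bot]
    exact Submodule.ker_liftQ_eq_bot _ _ _ hwj
  · obtain ⟨n, rfl⟩ := Nat.exists_eq_add_of_le' hn
    exact (ProjPresented.of_cokernel hji (exact_mkQ_range j) (Submodule.mkQ_surjective _)
      (.of_projective n B) ((hC (n + 1)).pi k)).finitelyPresented

end Copresentation

/-! ### Tensoring pure submodules with a bimodule -/

section Bimodule

variable {R S : Type u} [Ring R] [Ring S] {C : Type u} [AddCommGroup C] [Module S C]
  [Module Rᵐᵒᵖ C] [SMulCommClass S Rᵐᵒᵖ C]
  {Y Z : Type u} [AddCommGroup Y] [Module R Y] [AddCommGroup Z] [Module R Z]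

theorem smul_tmul_left (s : S) (c : C) (y : Y) : s • tmul R c y = tmul R (s • c) y := rfl

variable (S C) in
/-- The map `C ⊗ g : C ⊗_R Y → C ⊗_R Z`, as a map of `S`-modules. -/
def tensorMapₗ (g : Y →ₗ[R] Z) : BalancedTensor R C Y →ₗ[S] BalancedTensor R C Z where
  __ := tensorMap C g
  map_smul' s t := by
    change tensorMap C g (s • t) = s • tensorMap C g t
    induction t using tensor_induction with
    | h0 => simp
    | ht c y => rfl
    | hadd a b ha hb => simp only [smul_add, map_add, ha, hb]

variable (S) in
theorem tensorMapₗ_apply (g : Y →ₗ[R] Z) (t : BalancedTensor R C Y) :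
    tensorMapₗ S C g t = tensorMap C g t := rfl

variable (R S C Y) in
/-- The map `y ↦ (c ↦ c ⊗ y)` from `Y` to `Hom_S(C, C ⊗_R Y)`. -/
def tensorUnit : Y →+ (C →ₗ[S] BalancedTensor R C Y) :=
  AddMonoidHom.mk' (fun y =>
    { toFun := fun c => tmul R c y
      map_add' := fun c c' => add_tmul c c' y
      map_smul' := fun _ _ => rfl }) fun y y' => LinearMap.ext fun c => tmul_add c y y'

theorem tensorUnit_apply (y : Y) (c : C) : tensorUnit R S C Y y c = tmul R c y := rfl

variable (S) in
/-- The image of a pure submodule under `C ⊗_R -` is pure. -/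
theorem IsPure.range_tensorMap [Module.FinitePresentation Rᵐᵒᵖ C] {P : Submodule R Y}
    (hP : IsPure P) : IsPure (LinearMap.range (tensorMapₗ S C P.subtype)) := by
  have : SMulCommClass Rᵐᵒᵖ S C := SMulCommClass.symm _ _ _
  intro p q A x _ hx
  choose t ht using hx
  -- The system over `S` acts on `C ^ q` by right `R`-linear maps, so a solution in `C ⊗_R Y` is one
  -- tensor over `C ^ q`. The cokernel of `D` is finitely presented, and purity of `P` keeps its
  -- tensor product with `P` inside the one with `Y`.
  let D : (Fin q → C) →ₗ[Rᵐᵒᵖ] (Fin p → C) :=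
    { toFun := fun x i => ∑ j, A i j • x j
      map_add' := fun x y => funext fun i => by simp [smul_add, Finset.sum_add_distrib]
      map_smul' := fun r x => funext fun i => by
        simp only [Pi.smul_apply, Finset.smul_sum, RingHom.id_apply]
        exact Finset.sum_congr rfl fun j _ => smul_comm _ _ _ }
  have hD : ∀ {V : Type u} [AddCommGroup V] [Module R V] (ξ : BalancedTensor R (Fin q → C) V) i,
      balancedMap V (LinearMap.proj i : (Fin p → C) →ₗ[Rᵐᵒᵖ] C) (balancedMap V D ξ) =
        ∑ j, A i j • balancedMap V (LinearMap.proj j : (Fin q → C) →ₗ[Rᵐᵒᵖ] C) ξ := by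
    intro V _ _ ξ i
    induction ξ using tensor_induction with
    | h0 => simp
    | ht k y =>
      simp only [balancedMap_tmul, smul_tmul_left]
      exact sum_tmul Finset.univ (fun j => A i j • k j) y
    | hadd a b ha hb => simp only [map_add, smul_add, Finset.sum_add_distrib, ha, hb]
  obtain ⟨ξ, hξ⟩ := exists_tensor_fin x
  obtain ⟨τ, hτ⟩ := exists_tensor_fin t
  have hτξ : tensorMap (Fin p → C) P.subtype τ = balancedMap Y D ξ := by
    refine tensor_fin_ext fun i => ?_
    rw [hD, balancedMap_tensorMap, hτ]
    simp only [hξ]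
    exact ht i
  have : Module.FinitePresentation Rᵐᵒᵖ ((Fin p → C) ⧸ LinearMap.range D) :=
    Module.finitePresentation_of_surjective (LinearMap.range D).mkQ
      (Submodule.mkQ_surjective _) (by
        rw [Submodule.ker_mkQ]
        exact Submodule.FG.of_finite)
  have hex := fun (V : Type u) [AddCommGroup V] [Module R V] => balancedMap_exact (Y := V)
    (exact_mkQ_range D) (Submodule.mkQ_surjective _)
  have h0 : balancedMap P (LinearMap.range D).mkQ τ = 0 := by
    refine hP.tensorMap_injective ?_
    rw [← balancedMap_tensorMap, hτξ, (hex Y).apply_apply_eq_zero, map_zero]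
  obtain ⟨η, rfl⟩ := (hex P _).1 h0
  refine ⟨fun j => tensorMapₗ S C P.subtype (balancedMap P (LinearMap.proj j) η),
    fun j => ⟨_, rfl⟩, fun i => ?_⟩
  rw [← ht, ← hτ, hD]
  simp

/-- The map `(C ⊗_R Y) / (C ⊗_R P) ≃ C ⊗_R (Y / P)`. -/
noncomputable def tensorQuotientEquiv (P : Submodule R Y) :
    (BalancedTensor R C Y ⧸ LinearMap.range (tensorMapₗ S C P.subtype)) ≃ₗ[S]
      BalancedTensor R C (Y ⧸ P) :=
  (Submodule.quotEquivOfEq _ _ (by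
    ext t
    exact (tensorMap_exact (K := C) (exact_subtype_mkQ P) P.mkQ_surjective t).symm)).trans
  (LinearMap.quotKerEquivOfSurjective (tensorMapₗ S C P.mkQ)
    (tensorMap_surjective P.mkQ_surjective))

theorem tensorQuotientEquiv_mkQ (P : Submodule R Y) (t : BalancedTensor R C Y) :
    tensorQuotientEquiv (S := S) P (Submodule.mkQ _ t) = tensorMap C P.mkQ t := rfl

end Bimodule

/-! ### Evaluation and unit maps for a semidualizing bimodule -/

section Semidualizing

variable {n : ℕ} {R S : Type u} [Ring R] [Ring S] {C : Type u} [AddCommGroup C] [Module S C]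
  [Module Rᵐᵒᵖ C] [SMulCommClass S Rᵐᵒᵖ C]

namespace IsSemidualizing

theorem left_finitePresentation (hC : IsSemidualizing R S C) : Module.FinitePresentation S C :=
  (hC.left_resolution.projPresented 1).finitelyPresented.finitePresentation le_rfl

theorem right_finitePresentation (hC : IsSemidualizing R S C) :
    Module.FinitePresentation Rᵐᵒᵖ C :=
  (hC.right_resolution.projPresented 1).finitelyPresented.finitePresentation le_rfl

theorem left_faithful (hC : IsSemidualizing R S C) (s : S) (hs : ∀ c : C, s • c = 0) : s = 0 :=
  hC.left_homothety.1 (LinearMap.ext fun c => (hs c).trans (zero_smul S c).symm)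

theorem right_faithful (hC : IsSemidualizing R S C) (r : Rᵐᵒᵖ) (hr : ∀ c : C, r • c = 0) :
    r = 0 := by
  have : unop r = 0 := hC.right_homothety.1
    (LinearMap.ext fun c => (hr c).trans (zero_smul Rᵐᵒᵖ c).symm)
  exact unop_injective this

theorem exists_left_smul (hC : IsSemidualizing R S C) (h : C →ₗ[Rᵐᵒᵖ] C) :
    ∃ s : S, ∀ c, h c = s • c := by
  obtain ⟨s, rfl⟩ := hC.left_homothety.2 h
  exact ⟨s, fun _ => rfl⟩

theorem exists_right_smul (hC : IsSemidualizing R S C) (h : C →ₗ[S] C) :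
    ∃ r : Rᵐᵒᵖ, ∀ c, h c = r • c := by
  obtain ⟨r, rfl⟩ := hC.right_homothety.2 h
  exact ⟨op r, fun _ => rfl⟩

end IsSemidualizing

section Evaluation

variable {M X : Type u} [AddCommGroup M] [Module R M] [AddCommGroup X] [Module S X]

/-- The map `C ⊗_R M → X` induced by a map `M → Hom_S(C, X)`. -/
def tensorEval (e : M →+ (C →ₗ[S] X)) (he : ∀ (r : R) m c, e (r • m) c = e m (op r • c)) :
    BalancedTensor R C M →ₗ[S] X where
  __ := tensorLift (AddMonoidHom.mk' (fun c => AddMonoidHom.mk' (fun m => e m c) fun m m' => by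
    simp) fun c c' => AddMonoidHom.ext fun m => map_add (e m) c c') fun r c m => (he r m c).symm
  map_smul' s t := by
    change tensorLift _ _ (s • t) = s • tensorLift _ _ t
    induction t using tensor_induction with
    | h0 => simp
    | ht c m => exact map_smul (e m) s c
    | hadd a b ha hb => simp only [smul_add, map_add, ha, hb]

/-- For `fp_n`-injective `X`, the evaluation map `C ⊗_R Hom_S(C, X) → X` is bijective. -/
theorem tensorEval_bijective (hn : 1 ≤ n) (hC : IsSemidualizing R S C) (hX : IsFpInjective n S X)
    (e : M ≃+ (C →ₗ[S] X)) (he : ∀ (r : R) m c, e (r • m) c = e m (op r • c)) :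
    Function.Bijective (tensorEval (e : M →+ (C →ₗ[S] X)) he) := by
  have := hC.right_finitePresentation
  obtain ⟨k, m, c, a, hc, hac, ha⟩ := exists_generators_relations (R := Rᵐᵒᵖ) C
  have hproj := fun n => hC.left_resolution.projPresented n
  obtain ⟨j, w, hj, hji, hwi, hw, hfp⟩ := exists_copresentation (B := S) hn hC.left_faithful
    hC.exists_left_smul hproj hc hac ha
  have hsingle : ∀ {p : ℕ} (g : (Fin p → C) →ₗ[S] X) (x : Fin p → C),
      g x = ∑ i, g (Pi.single i (x i)) := fun g x => by
    rw [← map_sum, Finset.univ_sum_single]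
  constructor
  · refine (injective_iff_map_eq_zero _).2 fun t ht => ?_
    obtain ⟨y, rfl⟩ := exists_eq_sum_tmul hc t
    -- The vanishing of the evaluation says that `g` kills `j`. Hence `g` factors through the
    -- cokernel and extends along `w` to `C ^ m`; the components of the extension show that `∑ c i ⊗
    -- y i` is a consequence of the relations of `C`.
    let g : (Fin k → C) →ₗ[S] X := ∑ i, e (y i) ∘ₗ LinearMap.proj i
    have hg : ∀ x, g x = ∑ i, e (y i) (x i) := fun x => by simp [g]
    have hgj : LinearMap.range j ≤ LinearMap.ker g := by
      rintro _ ⟨s, rfl⟩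
      rw [LinearMap.mem_ker, hg]
      simp only [hj, map_smul, ← Finset.smul_sum]
      have ht' : ∑ i, e (y i) (c i) = 0 := (map_sum _ _ _).symm.trans ht
      rw [ht', smul_zero]
    obtain ⟨h, hh⟩ := hX (.of S ((Fin k → C) ⧸ LinearMap.range j)) (.of S (Fin m → C)) w hfp
      ((hproj n).pi m).finitelyPresented hwi ((LinearMap.range j).liftQ g hgj)
    have hh' : ∀ x, h (w (Submodule.mkQ _ x)) = g x := fun x =>
      LinearMap.congr_fun hh (Submodule.mkQ _ x)
    refine sum_tmul_eq_zero_of_relations hac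
      (fun l => e.symm (h ∘ₗ LinearMap.single S (fun _ => C) l)) fun i => e.injective ?_
    ext x
    have h1 : e (y i) x = g (Pi.single i x) := by
      rw [hg, Finset.sum_eq_single i]
      · simp
      · intro b _ hb
        simp [hb]
      · simp
    have h2 : ∀ l, w (Submodule.mkQ _ (Pi.single i x)) l = a l i • x := fun l => by
      rw [hw, Finset.sum_eq_single i]
      · simp
      · intro b _ hb
        simp [hb]
      · simp
    rw [h1, ← hh', hsingle h, map_sum, LinearMap.sum_apply]
    refine Finset.sum_congr rfl fun l _ => ?_
    rw [h2, he, op_unop, e.apply_symm_apply]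
    rfl
  · intro x
    -- The map `S → X` with `1 ↦ x` extends along `j : S → C ^ k`; as `j 1 = c`, the extension takes
    -- the value `x` at the tuple of generators.
    obtain ⟨g, hg⟩ := hX (.of S S) (.of S (Fin k → C)) j
      (ProjPresented.of_projective n S).finitelyPresented ((hproj n).pi k).finitelyPresented hji
      (LinearMap.toSpanSingleton S X x)
    have hg1 : g c = x := by
      have h1 := LinearMap.congr_fun hg 1
      have h2 : j 1 = c := funext fun i => by rw [hj, one_smul]
      have h3 : g (j 1) = LinearMap.toSpanSingleton S X x 1 := h1
      rwa [h2, LinearMap.toSpanSingleton_apply, one_smul] at h3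
    refine ⟨∑ i, tmul R (c i) (e.symm (g ∘ₗ LinearMap.single S (fun _ => C) i)), ?_⟩
    rw [map_sum, ← hg1, hsingle g c]
    refine Finset.sum_congr rfl fun i _ => ?_
    exact LinearMap.congr_fun (e.apply_symm_apply _) (c i)

end Evaluation

/-- For `fp_n`-flat `Y`, the map `Y → Hom_S(C, C ⊗_R Y)` is bijective. -/
theorem tensorUnit_bijective (hn : 1 ≤ n) (hC : IsSemidualizing R S C) {Y : Type u}
    [AddCommGroup Y] [Module R Y] (hY : IsFpFlat n R Y) :
    Function.Bijective (tensorUnit R S C Y) := by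
  have := hC.left_finitePresentation
  have : SMulCommClass Rᵐᵒᵖ S C := SMulCommClass.symm _ _ _
  obtain ⟨k, m, c, a, hc, hac, ha⟩ := exists_generators_relations (R := S) C
  have hproj := fun n => hC.right_resolution.projPresented n
  obtain ⟨j, w, hj, hji, hwi, hw, hfp⟩ := exists_copresentation (B := Rᵐᵒᵖ) hn hC.right_faithful
    hC.exists_right_smul hproj hc hac ha
  -- Flatness on the two monomorphisms `j` and `w` keeps `0 → R → C ^ k → C ^ m` exact after
  -- tensoring with `Y`, and the kernel of `(C ⊗ Y) ^ k → (C ⊗ Y) ^ m` is `Hom_S(C, C ⊗ Y)`.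
  have hjY : Function.Injective (balancedMap Y j) := hY (.of Rᵐᵒᵖ Rᵐᵒᵖ) (.of Rᵐᵒᵖ (Fin k → C)) j
    (ProjPresented.of_projective n Rᵐᵒᵖ).finitelyPresented ((hproj n).pi k).finitelyPresented hji
  have hwY : Function.Injective (balancedMap Y w) :=
    hY (.of Rᵐᵒᵖ ((Fin k → C) ⧸ LinearMap.range j)) (.of Rᵐᵒᵖ (Fin m → C)) w hfp
      ((hproj n).pi m).finitelyPresented hwi
  have hj1 : ∀ (y : Y) i, balancedMap Y (LinearMap.proj i : (Fin k → C) →ₗ[Rᵐᵒᵖ] C)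
      (balancedMap Y j (tmul R (1 : Rᵐᵒᵖ) y)) = tmul R (c i) y := fun y i => by
    rw [balancedMap_tmul, balancedMap_tmul, LinearMap.proj_apply, hj, one_smul]
  constructor
  · refine (injective_iff_map_eq_zero _).2 fun y hy => ?_
    refine eq_zero_of_one_tmul_eq_zero (hjY ?_)
    rw [map_zero]
    refine tensor_fin_ext fun i => ?_
    rw [hj1, map_zero]
    exact LinearMap.congr_fun hy (c i)
  · intro φ
    obtain ⟨τ, hτ⟩ := exists_tensor_fin fun i => φ (c i)
    have hwτ : ∀ (τ : BalancedTensor R (Fin k → C) Y) l,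
        balancedMap Y (LinearMap.proj l : (Fin m → C) →ₗ[Rᵐᵒᵖ] C)
          (balancedMap Y w (balancedMap Y (Submodule.mkQ _) τ)) =
        ∑ i, a l i • balancedMap Y (LinearMap.proj i : (Fin k → C) →ₗ[Rᵐᵒᵖ] C) τ := by
      intro τ l
      induction τ using tensor_induction with
      | h0 => simp
      | ht x y =>
        simp only [balancedMap_tmul, smul_tmul_left, LinearMap.proj_apply, hw]
        exact sum_tmul Finset.univ (fun i => a l i • x i) y
      | hadd s t hs ht => simp only [map_add, smul_add, Finset.sum_add_distrib, hs, ht]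
    have h0 : balancedMap Y (LinearMap.range j).mkQ τ = 0 := by
      refine hwY ?_
      rw [map_zero]
      refine tensor_fin_ext fun l => ?_
      rw [hwτ, map_zero]
      simp only [hτ, ← map_smul, ← map_sum, hac, map_zero]
    obtain ⟨ρ, hρ⟩ := (balancedMap_exact (exact_mkQ_range j) (Submodule.mkQ_surjective _) τ).1 h0
    obtain ⟨y, rfl⟩ := exists_one_tmul ρ
    refine ⟨y, linearMap_ext_of_generators hc fun i => ?_⟩
    rw [tensorUnit_apply, ← hj1, hρ, hτ]

/-! ### Purity closure of the `C`-`fp_n`-injective modules -/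

section CfpInjective

variable {M N : Type u} [AddCommGroup M] [Module R M] [AddCommGroup N] [Module R N]

theorem cfpInjective_iff : CfpInjective n R S C (.of R M) ↔ ∃ X : ModuleCat.{u} S,
    IsFpInjective n S X ∧ ∃ e : M ≃+ (C →ₗ[S] X), ∀ (r : R) m c, e (r • m) c = e m (op r • c) := by
  constructor
  · rintro ⟨X, hX, ⟨e⟩⟩
    let := homModule R S C X
    exact ⟨X, hX, e.toAddEquiv, fun r m c => LinearMap.congr_fun (e.map_smul r m) c⟩
  · rintro ⟨X, hX, e, he⟩
    let := homModule R S C X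
    exact ⟨X, hX, ⟨{ e with map_smul' := fun r m => LinearMap.ext fun c => he r m c }⟩⟩

theorem CfpInjective.of_equiv (e : M ≃ₗ[R] N) (h : CfpInjective n R S C (.of R M)) :
    CfpInjective n R S C (.of R N) := by
  rw [cfpInjective_iff] at h ⊢
  obtain ⟨X, hX, f, hf⟩ := h
  exact ⟨X, hX, e.symm.toAddEquiv.trans f, fun r m c => by simp [hf]⟩

/-- Since evaluation is bijective, the module `X` in the definition must be `C ⊗_R M`; this makes
membership a condition on `M` alone. -/
theorem cfpInjective_iff_tensorUnit (hn : 1 ≤ n) (hC : IsSemidualizing R S C) :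
    CfpInjective n R S C (.of R M) ↔ Function.Bijective (tensorUnit R S C M) ∧
      IsFpInjective n S (BalancedTensor R C M) := by
  rw [cfpInjective_iff]
  constructor
  · rintro ⟨X, hX, e, he⟩
    have hb := tensorEval_bijective hn hC hX e he
    let ev : BalancedTensor R C M ≃ₗ[S] X := LinearEquiv.ofBijective _ hb
    have hev : ∀ m c, ev (tensorUnit R S C M m c) = e m c := fun _ _ => rfl
    refine ⟨⟨fun m m' h => e.injective ?_, fun φ => ⟨e.symm ((ev : _ →ₗ[S] X) ∘ₗ φ), ?_⟩⟩,
      hX.of_equiv ev.symm⟩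
    · ext c
      rw [← hev, h, hev]
    · ext c
      apply ev.injective
      rw [hev, e.apply_symm_apply]
      rfl
  · rintro ⟨hb, hX⟩
    exact ⟨.of S (BalancedTensor R C M), hX, AddEquiv.ofBijective _ hb, fun r m c =>
      (smul_tmul (op r) c m).symm⟩

theorem CfpInjective.pi {ι : Type u} {M : ι → Type u} [∀ j, AddCommGroup (M j)]
    [∀ j, Module R (M j)] (h : ∀ j, CfpInjective n R S C (.of R (M j))) :
    CfpInjective n R S C (.of R (∀ j, M j)) := by
  simp only [cfpInjective_iff] at h
  choose X hX e he using h
  rw [cfpInjective_iff]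
  refine ⟨.of S (∀ j, X j), IsFpInjective.pi hX,
    { toFun := fun m => LinearMap.pi fun j => e j (m j)
      invFun := fun φ j => (e j).symm (LinearMap.proj j ∘ₗ φ)
      left_inv := fun m => funext fun j => ?_
      right_inv := fun φ => LinearMap.ext fun c => funext fun j => ?_
      map_add' := fun m₁ m₂ => LinearMap.ext fun c => funext fun j => ?_ },
    fun r m c => funext fun j => he j r (m j) c⟩
  · rw [AddEquiv.symm_apply_eq]
    rfl
  · exact LinearMap.congr_fun ((e j).apply_symm_apply _) c
  · exact LinearMap.congr_fun ((e j).map_add (m₁ j) (m₂ j)) c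

/-- Elements of `M` which `C ⊗_R -` cannot separate from a pure submodule belong to it. -/
theorem IsPure.mem_of_tmul_mem_range [Module.Finite S C] [Module.FinitePresentation Rᵐᵒᵖ C]
    {P : Submodule R M} (hP : IsPure P) (hinj : Function.Injective (tensorUnit R S C M)) {y : M}
    (hy : ∀ c : C, tmul R c y ∈ LinearMap.range (tensorMapₗ S C P.subtype)) : y ∈ P := by
  obtain ⟨k, c, hc⟩ := Module.Finite.exists_fin (R := S) (M := C)
  choose t ht using fun i => hy (c i)
  obtain ⟨τ, hτ⟩ := exists_tensor_fin t
  -- The map `1 ↦ c` into `C ^ k`, with `c` the generators. Its cokernel is finitely presented, so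
  -- purity of `P` pulls `τ` back to an element `1 ⊗ p` with `p ∈ P`, and injectivity of the unit
  -- map gives `p = y`.
  let γ : Rᵐᵒᵖ →ₗ[Rᵐᵒᵖ] (Fin k → C) := LinearMap.toSpanSingleton Rᵐᵒᵖ _ c
  have : Module.FinitePresentation Rᵐᵒᵖ ((Fin k → C) ⧸ LinearMap.range γ) :=
    Module.finitePresentation_of_surjective (LinearMap.range γ).mkQ
      (Submodule.mkQ_surjective _) (by
        rw [Submodule.ker_mkQ]
        exact Submodule.FG.of_finite)
  have hex := fun (V : Type u) [AddCommGroup V] [Module R V] => balancedMap_exact (Y := V)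
    (exact_mkQ_range γ) (Submodule.mkQ_surjective _)
  have hγ : ∀ {V : Type u} [AddCommGroup V] [Module R V] (v : V) i,
      balancedMap V (LinearMap.proj i : (Fin k → C) →ₗ[Rᵐᵒᵖ] C)
        (balancedMap V γ (tmul R (1 : Rᵐᵒᵖ) v)) = tmul R (c i) v := fun v i => by
    rw [balancedMap_tmul, balancedMap_tmul]
    simp [γ]
  have hτy : tensorMap (Fin k → C) P.subtype τ = balancedMap M γ (tmul R 1 y) := by
    refine tensor_fin_ext fun i => ?_
    rw [balancedMap_tensorMap, hτ, hγ]
    exact ht i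
  have h0 : balancedMap P (LinearMap.range γ).mkQ τ = 0 := by
    refine hP.tensorMap_injective ?_
    rw [← balancedMap_tensorMap, hτy, (hex M).apply_apply_eq_zero, map_zero]
  obtain ⟨ρ, rfl⟩ := (hex P _).1 h0
  obtain ⟨p, rfl⟩ := exists_one_tmul ρ
  suffices h : (p : M) = y from h ▸ p.2
  refine hinj (LinearMap.ext_on_range hc fun i => ?_)
  rw [tensorUnit_apply, tensorUnit_apply, ← hγ y, ← hτy, balancedMap_tensorMap, hγ]
  rfl

/-- `C ⊗ P` is pure in `C ⊗ M`, hence `fp_n`-injective. A map `C → C ⊗ P` is given by some `y ∈ M`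
with all `c ⊗ y` in `C ⊗ P`, which forces `y ∈ P`. -/
theorem CfpInjective.pure_sub (hn : 1 ≤ n) (hC : IsSemidualizing R S C) (P : Submodule R M)
    (hM : CfpInjective n R S C (.of R M)) (hP : IsPure P) : CfpInjective n R S C (.of R P) := by
  have := hC.left_finitePresentation
  have := hC.right_finitePresentation
  rw [cfpInjective_iff_tensorUnit hn hC] at hM ⊢
  obtain ⟨hu, hX⟩ := hM
  have hinj : Function.Injective (tensorMapₗ S C P.subtype) := hP.tensorMap_injective
  refine ⟨⟨fun p p' h => Subtype.ext (hu.1 ?_), fun φ => ?_⟩,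
    (hX.pure_sub hn (hP.range_tensorMap S)).of_equiv (LinearEquiv.ofInjective _ hinj).symm⟩
  · ext c
    exact congrArg (tensorMapₗ S C P.subtype) (LinearMap.congr_fun h c)
  · obtain ⟨y, hy⟩ := hu.2 (tensorMapₗ S C P.subtype ∘ₗ φ)
    have hy' : ∀ c, tmul R c y = tensorMapₗ S C P.subtype (φ c) := LinearMap.congr_fun hy
    have hyP : y ∈ P := hP.mem_of_tmul_mem_range hu.1 fun c => ⟨φ c, (hy' c).symm⟩
    refine ⟨⟨y, hyP⟩, LinearMap.ext fun c => hinj ?_⟩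
    rw [← hy']
    rfl

theorem CfpInjective.pure_quotient (hn : 1 ≤ n) (hC : IsSemidualizing R S C) (P : Submodule R M)
    (hM : CfpInjective n R S C (.of R M)) (hP : IsPure P) :
    CfpInjective n R S C (.of R (M ⧸ P)) := by
  have := hC.left_finitePresentation
  have := hC.right_finitePresentation
  rw [cfpInjective_iff_tensorUnit hn hC] at hM ⊢
  obtain ⟨hu, hX⟩ := hM
  have hrange := hP.range_tensorMap (C := C) S
  refine ⟨⟨(injective_iff_map_eq_zero _).2 fun q hq => ?_, fun φ => ?_⟩,
    (hX.pure_quotient hn hrange).of_equiv (tensorQuotientEquiv P)⟩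
  · obtain ⟨y, rfl⟩ := P.mkQ_surjective q
    have : y ∈ P := hP.mem_of_tmul_mem_range hu.1 fun c =>
      (tensorMap_exact (K := C) (exact_subtype_mkQ P) P.mkQ_surjective (tmul R c y)).1
        (LinearMap.congr_fun hq c)
    rwa [← LinearMap.mem_ker, Submodule.ker_mkQ]
  -- Finite presentation of `C` over `S` lifts a map to `C ⊗ (M ⧸ P)` to one to `C ⊗ M`, which comes
  -- from an element of `M`.
  · obtain ⟨h, hh⟩ := hrange.exists_lift
      ((tensorQuotientEquiv (S := S) (C := C) P).symm.toLinearMap ∘ₗ φ)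
    obtain ⟨y, rfl⟩ := hu.2 h
    refine ⟨P.mkQ y, LinearMap.ext fun c => ?_⟩
    have := congrArg (tensorQuotientEquiv (S := S) P) (LinearMap.congr_fun hh c)
    simp only [LinearMap.comp_apply, tensorQuotientEquiv_mkQ, LinearEquiv.coe_coe,
      LinearEquiv.apply_symm_apply] at this
    exact this

theorem isPurityClosed_cfpInjective (hn : 1 ≤ n) (hC : IsSemidualizing R S C) :
    IsPurityClosed (CfpInjective n R S C) where
  of_equiv := CfpInjective.of_equiv
  pi _ := CfpInjective.pi
  pure_sub := CfpInjective.pure_sub hn hC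
  pure_quotient := CfpInjective.pure_quotient hn hC

end CfpInjective

/-! ### Purity closure of the `C`-`fp_n`-flat modules -/

section CfpFlat

variable {Y : Type u} [AddCommGroup Y] [Module R Y]

/-- The elements `y` of `Y` such that `c ⊗ y` lies in `N` for all `c`. -/
def tensorPreimage (N : Submodule S (BalancedTensor R C Y)) : Submodule R Y where
  carrier := {y | ∀ c : C, tmul R c y ∈ N}
  add_mem' {y y'} hy hy' c := by
    rw [tmul_add]
    exact N.add_mem (hy c) (hy' c)
  zero_mem' c := by
    rw [tmul_zero]
    exact N.zero_mem
  smul_mem' r y hy c := by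
    have := hy (op r • c)
    rwa [smul_tmul] at this

/-- Tuples of elements of `Y` can be corrected modulo `tensorPreimage N` to satisfy finitely many
relations which they satisfy modulo a pure submodule `N`. -/
theorem exists_correction [Module.FinitePresentation S C]
    (hu : Function.Bijective (tensorUnit R S C Y)) {N : Submodule S (BalancedTensor R C Y)}
    (hN : IsPure N) {k : ℕ} {U : Submodule S (Fin k → C)} (hU : U.FG) (y : Fin k → Y)
    (hy : ∀ x ∈ U, ∑ i, tmul R (x i) (y i) ∈ N) :
    ∃ z : Fin k → Y, (∀ x ∈ U, ∑ i, tmul R (x i) (z i) = 0) ∧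
      ∀ i, y i - z i ∈ tensorPreimage N := by
  -- The tuple `y` as a map `C ^ k → C ⊗ Y`. Modulo `N` it factors through the finitely presented `C
  -- ^ k ⧸ U` and lifts from there by purity; the components of the lift are given by elements `z i`
  -- because the unit map is surjective.
  let f : (Fin k → C) →ₗ[S] BalancedTensor R C Y :=
    ∑ i, tensorUnit R S C Y (y i) ∘ₗ LinearMap.proj i
  have hf : ∀ x, f x = ∑ i, tmul R (x i) (y i) := fun x => by simp [f, tensorUnit_apply]
  have : Module.FinitePresentation S ((Fin k → C) ⧸ U) :=
    Module.finitePresentation_of_surjective U.mkQ U.mkQ_surjective (by rwa [Submodule.ker_mkQ])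
  obtain ⟨h, hh⟩ := hN.exists_lift (U.liftQ (N.mkQ ∘ₗ f) fun x hx => by
    rw [LinearMap.mem_ker, LinearMap.comp_apply, ← LinearMap.mem_ker, Submodule.ker_mkQ, hf]
    exact hy x hx)
  have hh' : ∀ x, N.mkQ (h (U.mkQ x)) = N.mkQ (f x) := fun x => LinearMap.congr_fun hh (U.mkQ x)
  choose z hz using fun i => hu.2 (h ∘ₗ U.mkQ ∘ₗ LinearMap.single S (fun _ => C) i)
  have hz' : ∀ i c, tmul R c (z i) = h (U.mkQ (Pi.single i c)) := fun i c =>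
    LinearMap.congr_fun (hz i) c
  refine ⟨z, fun x hx => ?_, fun i c => ?_⟩
  · simp only [hz', ← map_sum, Finset.univ_sum_single]
    have : U.mkQ x = 0 := by rwa [← LinearMap.mem_ker, Submodule.ker_mkQ]
    rw [this, map_zero]
  · have hfc : f (Pi.single i c) = tmul R c (y i) := by
      rw [hf, Finset.sum_eq_single i]
      · simp
      · intro j _ hj
        simp [hj, zero_tmul]
      · simp
    rw [tmul_sub, hz', ← hfc, ← Submodule.ker_mkQ N, LinearMap.mem_ker, map_sub, hh', sub_self]

/-- `exists_correction` is applied with `U` the range of the transposed system on powers of `C`. The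
correction `z` then solves the homogeneous system, by injectivity of the unit map, so `y - z` is the
solution sought. -/
theorem isPure_tensorPreimage [Module.FinitePresentation S C]
    (hu : Function.Bijective (tensorUnit R S C Y)) {N : Submodule S (BalancedTensor R C Y)}
    (hN : IsPure N) : IsPure (tensorPreimage N) := by
  have : SMulCommClass Rᵐᵒᵖ S C := SMulCommClass.symm _ _ _
  intro p q A y _ hy
  let D : (Fin p → C) →ₗ[S] (Fin q → C) :=
    { toFun := fun x j => ∑ i, op (A i j) • x i
      map_add' := fun x y => funext fun i => by simp [smul_add, Finset.sum_add_distrib]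
      map_smul' := fun r x => funext fun i => by
        simp only [Pi.smul_apply, Finset.smul_sum, RingHom.id_apply]
        exact Finset.sum_congr rfl fun j _ => smul_comm _ _ _ }
  have hD : ∀ (y : Fin q → Y) (x : Fin p → C),
      ∑ j, tmul R (D x j) (y j) = ∑ i, tmul R (x i) (∑ j, A i j • y j) := by
    intro y x
    have h : ∀ j, D x j = ∑ i, op (A i j) • x i := fun _ => rfl
    simp only [h, sum_tmul, smul_tmul, tmul_sum, unop_op]
    exact Finset.sum_comm
  obtain ⟨z, hz, hyz⟩ := exists_correction hu hN (U := LinearMap.range D) Submodule.FG.of_finite y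
    (by
      rintro _ ⟨x, rfl⟩
      rw [hD]
      exact N.sum_mem fun i _ => hy i (x i))
  refine ⟨y - z, hyz, fun i => ?_⟩
  simp only [Pi.sub_apply, smul_sub, Finset.sum_sub_distrib, sub_eq_self]
  refine hu.1 (LinearMap.ext fun c => ?_)
  have h := hz _ ⟨Pi.single i c, rfl⟩
  rw [hD, Finset.sum_eq_single i] at h
  · change tmul R c (∑ j, A i j • z j) = tensorUnit R S C Y 0 c
    rw [map_zero]
    simpa using h
  · intro j _ hj
    simp [hj, zero_tmul]
  · simp

/-- Write `t ∈ N` as `∑ c i ⊗ y i` and correct with `U` spanned by the tuple `c`: then `∑ c i ⊗ z i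
= 0`, so `t = ∑ c i ⊗ (y i - z i)` with all `y i - z i` in the preimage. -/
theorem range_tensorMap_tensorPreimage [Module.FinitePresentation S C]
    [Module.FinitePresentation Rᵐᵒᵖ C] (hu : Function.Bijective (tensorUnit R S C Y))
    {N : Submodule S (BalancedTensor R C Y)} (hN : IsPure N) :
    LinearMap.range (tensorMapₗ S C (tensorPreimage N).subtype) = N := by
  apply le_antisymm
  · rintro _ ⟨t, rfl⟩
    induction t using tensor_induction with
    | h0 => simp
    | ht c y => exact y.2 c
    | hadd s t hs ht =>
      rw [map_add]
      exact N.add_mem hs ht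
  · intro t ht
    obtain ⟨k, m, c, a, hc, -, -⟩ := exists_generators_relations (R := Rᵐᵒᵖ) C
    obtain ⟨y, rfl⟩ := exists_eq_sum_tmul hc t
    obtain ⟨z, hz, hyz⟩ := exists_correction hu hN (U := Submodule.span S {c})
      (Submodule.fg_span_singleton c) y (by
        intro x hx
        obtain ⟨s, rfl⟩ := Submodule.mem_span_singleton.1 hx
        simp only [Pi.smul_apply, ← smul_tmul_left, ← Finset.smul_sum]
        exact N.smul_mem s ht)
    refine ⟨∑ i, tmul R (c i) ⟨y i - z i, hyz i⟩, ?_⟩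
    rw [map_sum]
    simp only [tensorMapₗ_apply, tensorMap_tmul, Submodule.subtype_apply, tmul_sub,
      Finset.sum_sub_distrib, hz c (Submodule.mem_span_singleton_self c), sub_zero]

variable {M N : Type u} [AddCommGroup M] [Module S M] [AddCommGroup N] [Module S N]

theorem CfpFlat.of_equiv (e : M ≃ₗ[S] N) (h : CfpFlat n R S C (.of S M)) :
    CfpFlat n R S C (.of S N) := by
  obtain ⟨Y, hY, ⟨f⟩⟩ := h
  exact ⟨Y, hY, ⟨e.symm.trans f⟩⟩

theorem CfpFlat.pi (hn : 1 ≤ n) (hC : IsSemidualizing R S C) {ι : Type u} {M : ι → Type u}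
    [∀ j, AddCommGroup (M j)] [∀ j, Module S (M j)]
    (h : ∀ j, CfpFlat n R S C (.of S (M j))) : CfpFlat n R S C (.of S (∀ j, M j)) := by
  have := hC.right_finitePresentation
  choose Y hY e using h
  let φ : BalancedTensor R C (∀ j, Y j) →ₗ[S] ∀ j, BalancedTensor R C (Y j) :=
    LinearMap.pi fun j => tensorMapₗ S C (LinearMap.proj j)
  have hφ : Function.Bijective φ := by
    constructor
    · exact (injective_iff_map_eq_zero _).2 fun t ht => tensor_pi_injective fun j => congrFun ht j
    · intro s
      obtain ⟨t, ht⟩ := tensor_pi_surjective s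
      exact ⟨t, funext ht⟩
  exact ⟨.of R (∀ j, Y j), IsFpFlat.pi hn hY,
    ⟨(LinearEquiv.piCongrRight fun j => (e j).some).trans (LinearEquiv.ofBijective φ hφ).symm⟩⟩

theorem cfpFlat_of_isPure (hn : 1 ≤ n) (hC : IsSemidualizing R S C) (hY : IsFpFlat n R Y)
    {N : Submodule S (BalancedTensor R C Y)} (hN : IsPure N) : CfpFlat n R S C (.of S N) := by
  have := hC.left_finitePresentation
  have := hC.right_finitePresentation
  have hu := tensorUnit_bijective hn hC hY
  have hpure := isPure_tensorPreimage hu hN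
  have hinj : Function.Injective (tensorMapₗ S C (tensorPreimage N).subtype) :=
    hpure.tensorMap_injective
  exact ⟨.of R (tensorPreimage N), hY.pure_sub hn hpure, ⟨(LinearEquiv.ofEq _ _
    (range_tensorMap_tensorPreimage hu hN).symm).trans (LinearEquiv.ofInjective _ hinj).symm⟩⟩

theorem cfpFlat_quotient_of_isPure (hn : 1 ≤ n) (hC : IsSemidualizing R S C)
    (hY : IsFpFlat n R Y) {N : Submodule S (BalancedTensor R C Y)} (hN : IsPure N) :
    CfpFlat n R S C (.of S (BalancedTensor R C Y ⧸ N)) := by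
  have := hC.left_finitePresentation
  have := hC.right_finitePresentation
  have hu := tensorUnit_bijective hn hC hY
  exact ⟨.of R (Y ⧸ tensorPreimage N), hY.pure_quotient hn (isPure_tensorPreimage hu hN),
    ⟨(Submodule.quotEquivOfEq _ _ (range_tensorMap_tensorPreimage hu hN).symm).trans
      (tensorQuotientEquiv (tensorPreimage N))⟩⟩

theorem CfpFlat.pure_sub (hn : 1 ≤ n) (hC : IsSemidualizing R S C) (P : Submodule S M)
    (hM : CfpFlat n R S C (.of S M)) (hP : IsPure P) : CfpFlat n R S C (.of S P) := by
  obtain ⟨Y, hY, ⟨e⟩⟩ := hM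
  let e' : M ≃ₗ[S] BalancedTensor R C Y := e
  exact .of_equiv (e'.submoduleMap P).symm (cfpFlat_of_isPure hn hC hY (isPure_map_equiv e' hP))

theorem CfpFlat.pure_quotient (hn : 1 ≤ n) (hC : IsSemidualizing R S C) (P : Submodule S M)
    (hM : CfpFlat n R S C (.of S M)) (hP : IsPure P) : CfpFlat n R S C (.of S (M ⧸ P)) := by
  obtain ⟨Y, hY, ⟨e⟩⟩ := hM
  let e' : M ≃ₗ[S] BalancedTensor R C Y := e
  exact .of_equiv (Submodule.Quotient.equiv P _ e' rfl).symm
    (cfpFlat_quotient_of_isPure hn hC hY (isPure_map_equiv e' hP))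

theorem isPurityClosed_cfpFlat (hn : 1 ≤ n) (hC : IsSemidualizing R S C) :
    IsPurityClosed (CfpFlat n R S C) where
  of_equiv := CfpFlat.of_equiv
  pi _ := CfpFlat.pi hn hC
  pure_sub := CfpFlat.pure_sub hn hC
  pure_quotient := CfpFlat.pure_quotient hn hC

end CfpFlat

end Semidualizing

end CfpModules

theorem theorem3p13 (n : ℕ) (hn : 1 ≤ n) (R S : Type u) [Ring R] [Ring S]
    (C : Type u) [AddCommGroup C] [Module S C] [Module Rᵐᵒᵖ C] [SMulCommClass S Rᵐᵒᵖ C]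
    (hC : CfpModules.IsSemidualizing R S C) :
    (CfpModules.IsPreenveloping (CfpModules.CfpInjective n R S C) ∧
      CfpModules.IsCovering (CfpModules.CfpInjective n R S C)) ∧
    (CfpModules.IsPreenveloping (CfpModules.CfpFlat n R S C) ∧
      CfpModules.IsCovering (CfpModules.CfpFlat n R S C)) :=
  have hI := CfpModules.isPurityClosed_cfpInjective hn hC
  have hF := CfpModules.isPurityClosed_cfpFlat hn hC
  ⟨⟨hI.isPreenveloping, hI.isCovering⟩, hF.isPreenveloping, hF.isCovering⟩
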